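/- **Setting.** Let $x^+=f(x,u,\xi)=Ax+Bu+c+\xi$ with $x,\xi\in\mathbb R^n$, $u\in\mathbb R^m$, where the noise vectors $\xi_0,\xi_1,\dots$ are i.i.d. and square integrable with mean $\mu$ and covariance $\Sigma$. Let $\gamma\in(0,1)$ and let $(\sqrt\gamma A,\sqrt\gamma B)$ be stabilizable. Let $$\ell(x,u)=\begin{bmatrix}x\\u\end{bmatrix}^\top\begin{bmatrix}L_{xx}&L_{xu}\\L_{xu}^\top&L_{uu}\end{bmatrix}\begin{bmatrix}x\\u\end{bmatrix}+2\begin{bmatrix}x\\u\end{bmatrix}^\top\begin{bmatrix}L_x\\L_u\end{bmatrix}+L_c\;\ge 0$$ with $L_{xx},L_{uu}$ symmetric, and suppose that $\{u:\ell(x,u)\le r\}$ is compact for all $x\in\mathbb R^n$, $r\in\mathbb R$. For a measurable stationary policy $\pi:\mathbb R^n\to\mathbb R^m$ let $v_\pi(x)=\mathbb E\big[\sum_{k\ge0}\gamma^k\ell(x_k,\pi(x_k))\,\big|\,x_0=x\big]\in[0,\infty]$ be its discounted cost; $\pi$ is optimal if $v_\pi(x)\le v_{\pi'}(x)$ for all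 $x$ and all measurable $\pi'$. The Bellman operator for $Q$-functions is $$(\mathcal Fq)(x,u)=\ell(x,u)+\gamma\,\mathbb E\Big[\inf_{w\in\mathbb R^m}q(f(x,u,\xi),w)\Big].$$ By a fixed point of $\mathcal F$ we mean a measurable function $q:\mathbb R^n\times\mathbb R^m\to\mathbb R$, bounded below, for which these expectations are of integrable functions and $\mathcal Fq=q$. For a weight $z>0$ let $\mathcal S_z$ be the space of measurable $g:\mathbb R^n\times\mathbb R^m\to\mathbb R$ with $\sup_{x,u}|g(x,u)|/z(x,u)<\infty$. Put $\tilde A=\begin{bmatrix}A&c+\mu\\0&1\end{bmatrix}$, $\tilde B=\begin{bmatrix}B\\0\end{bmatrix}$, $\tilde L_{xx}=\begin{bmatrix}L_{xx}&L_x\\L_x^\top&L_c\end{bmatrix}$, $\tilde L_{xu}=\begin{bmatrix}L_{xu}\\L_u^\top\end{bmatrix}$ and, for a symmetric $(n+1)\times(n+1)$ matrix $\tilde P$, $$\begin{bmatrix}\tilde q&\tilde q_\ell\\\tilde q_\ell^\top&\tilde q_c\end{bmatrix}=\begin{bmatrix}\tilde L_{xx}+\gamma\tilde A^\top\tilde P\tilde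 A&\tilde L_{xu}+\gamma\tilde A^\top\tilde P\tilde B\\\tilde L_{xu}^\top+\gamma\tilde B^\top\tilde P\tilde A&L_{uu}+\gamma\tilde B^\top\tilde P\tilde B\end{bmatrix}.$$ The augmented Riccati equation (ARE) is $\tilde P=\tilde q-\tilde q_\ell\tilde q_c^{-1}\tilde q_\ell^\top$. **Claim.** 1. The ARE has a least positive semidefinite solution $\tilde P^*=\begin{bmatrix}P^*&P^*_\ell\\P_\ell^{*\top}&P^*_c\end{bmatrix}$ (in the Loewner order). If $P^*$ is positive definite (in particular, if $\tilde P^*$ is), then $\tilde P^*$ is the only positive semidefinite solution. If $\begin{bmatrix}\tilde L_{xx}&\tilde L_{xu}\\\tilde L_{xu}^\top&L_{uu}\end{bmatrix}$ is positive definite, then so is $\tilde P^*$. 2. Let $\tilde q^*,\tilde q^*_\ell,\tilde q^*_c$ be the blocks above for $\tilde P=\tilde P^*$. Writing $$\begin{bmatrix}\tilde q^*&\tilde q^*_\ell\\\tilde q^{*\top}_\ell&\tilde q^*_c\end{bmatrix}=\begin{bmatrix}q^*&q^*_x&q^*_\ell\\q_x^{*\top}&Q^*_c&q_u^{*\top}\\q_\ell^{*\top}&q^*_u&q^*_c\end{bmatrix},$$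 one has $q^*=L_{xx}+\gamma A^\top P^*A$, $q^*_\ell=L_{xu}+\gamma A^\top P^*B$, $q^*_c=L_{uu}+\gamma B^\top P^*B$. With $Q^*=\begin{bmatrix}q^*&q^*_\ell\\q_\ell^{*\top}&q^*_c\end{bmatrix}$, $Q^*_\ell=\begin{bmatrix}q^*_x\\q^*_u\end{bmatrix}$, the function $$q^*(x,u)=\begin{bmatrix}x\\u\end{bmatrix}^\top Q^*\begin{bmatrix}x\\u\end{bmatrix}+2\begin{bmatrix}x\\u\end{bmatrix}^\top Q^*_\ell+Q^*_c+\frac{\gamma\,\mathrm{Tr}(P^*\Sigma)}{1-\gamma}$$ is a fixed point of $\mathcal F$. It is non-negative, lies in $\mathcal S_z$ for $z=1+|x|^2+|u|^2$, is the (pointwise) least fixed point of $\mathcal F$, and is the unique fixed point of $\mathcal F$ in $\mathcal S_{1+q^*}$. If $P^*$ is positive definite, it is also the unique fixed point in $\mathcal S_z$ for $z=1+|x|^2+|u|^2$. 3. $q^*_c$ is positive definite, and the affine policy $$\pi^*(x)=-q_c^{*-1}(q_\ell^{*\top}x+q),\qquad q=L_u+\gamma B^\top(P^*_\ell+P^*(c+\mu)),$$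 is the unique optimal policy. For every $x$, $\pi^*(x)$ is the unique minimizer of $u\mapsto q^*(x,u)$, and $v_{\pi^*}(x)=\min_uq^*(x,u)$. -/

import Mathlib

open MeasureTheory ProbabilityTheory Matrix

noncomputable section

namespace AffineLQ

/-! ### Problem data -/

/-- Data of a discounted affine control problem with generalized quadratic stage-cost:
the dynamics `A x + B u + c + ξ`, the discount factor `γ`, and the blocks of the stage-cost. -/
structure Problem (n m : ℕ) where
  A : Matrix (Fin n) (Fin n) ℝ
  B : Matrix (Fin n) (Fin m) ℝ
  c : Fin n → ℝ
  γ : ℝ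
  Lxx : Matrix (Fin n) (Fin n) ℝ
  Lxu : Matrix (Fin n) (Fin m) ℝ
  Luu : Matrix (Fin m) (Fin m) ℝ
  Lx : Fin n → ℝ
  Lu : Fin m → ℝ
  Lc : ℝ

/-- A real matrix is Schur stable if all its complex eigenvalues have modulus less than one. -/
def IsSchurStable {n : ℕ} (M : Matrix (Fin n) (Fin n) ℝ) : Prop :=
  ∀ z ∈ spectrum ℂ (M.map (fun r : ℝ => (r : ℂ))), ‖z‖ < 1

/-- The pair `(A, B)` is stabilizable: some feedback gain `K` makes `A + B K` Schur stable. -/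
def IsStabilizable {n m : ℕ} (A : Matrix (Fin n) (Fin n) ℝ) (B : Matrix (Fin n) (Fin m) ℝ) : Prop :=
  ∃ K : Matrix (Fin m) (Fin n) ℝ, IsSchurStable (A + B * K)

/-- The generalized quadratic function
`(x, u) ↦ [x; u]ᵀ [M N; Nᵀ R] [x; u] + 2 [x; u]ᵀ [a; b] + s`. -/
def genQuad {n m : ℕ} (M : Matrix (Fin n) (Fin n) ℝ) (N : Matrix (Fin n) (Fin m) ℝ)
    (R : Matrix (Fin m) (Fin m) ℝ) (a : Fin n → ℝ) (b : Fin m → ℝ) (s : ℝ)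
    (x : Fin n → ℝ) (u : Fin m → ℝ) : ℝ :=
  Sum.elim x u ⬝ᵥ (Matrix.fromBlocks M N Nᵀ R *ᵥ Sum.elim x u)
    + 2 * (Sum.elim x u ⬝ᵥ Sum.elim a b) + s

variable {n m : ℕ}

/-- The dynamics `f(x, u, ξ) = A x + B u + c + ξ`. -/
def Problem.dyn (D : Problem n m) (x : Fin n → ℝ) (u : Fin m → ℝ) (e : Fin n → ℝ) : Fin n → ℝ :=
  D.A *ᵥ x + D.B *ᵥ u + D.c + e

/-- The generalized quadratic stage-cost `ℓ(x, u)`. -/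
def Problem.cost (D : Problem n m) (x : Fin n → ℝ) (u : Fin m → ℝ) : ℝ :=
  genQuad D.Lxx D.Lxu D.Luu D.Lx D.Lu D.Lc x u

/-! ### The noise -/

/-- Mean vector of a random vector. -/
def meanVec {Ω : Type*} [MeasurableSpace Ω] (Pr : Measure Ω) (ξ : Ω → Fin n → ℝ) : Fin n → ℝ :=
  fun i => ∫ ω, ξ ω i ∂Pr

/-- Covariance matrix of a random vector. -/
def covMat {Ω : Type*} [MeasurableSpace Ω] (Pr : Measure Ω) (ξ : Ω → Fin n → ℝ) :
    Matrix (Fin n) (Fin n) ℝ :=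
  Matrix.of fun i j => covariance (fun ω => ξ ω i) (fun ω => ξ ω j) Pr

/-! ### Policies and the discounted infinite-horizon cost -/

/-- The closed-loop trajectory under the stationary feedback policy `π`, started at `x`. -/
def Problem.traj (D : Problem n m) {Ω : Type*} (ξ : ℕ → Ω → Fin n → ℝ)
    (π : (Fin n → ℝ) → (Fin m → ℝ)) (x : Fin n → ℝ) : ℕ → Ω → Fin n → ℝ
  | 0, _ => x
  | k + 1, ω => D.dyn (D.traj ξ π x k ω) (π (D.traj ξ π x k ω)) (ξ k ω)

/-- The expected discounted cost `v_π(x)` (in `[0, ∞]`; it is used for non-negative stage-costs). -/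
def Problem.policyCost (D : Problem n m) {Ω : Type*} [MeasurableSpace Ω] (Pr : Measure Ω)
    (ξ : ℕ → Ω → Fin n → ℝ) (π : (Fin n → ℝ) → (Fin m → ℝ)) (x : Fin n → ℝ) : ENNReal :=
  ∫⁻ ω, ∑' k : ℕ,
    ENNReal.ofReal (D.γ ^ k * D.cost (D.traj ξ π x k ω) (π (D.traj ξ π x k ω))) ∂Pr

/-- A measurable stationary policy is optimal if it minimizes the discounted cost from every initial
state among all measurable stationary policies. -/
def Problem.IsOptimalPolicy (D : Problem n m) {Ω : Type*} [MeasurableSpace Ω] (Pr : Measure Ω)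
    (ξ : ℕ → Ω → Fin n → ℝ) (π : (Fin n → ℝ) → (Fin m → ℝ)) : Prop :=
  Measurable π ∧ ∀ π' : (Fin n → ℝ) → (Fin m → ℝ), Measurable π' →
    ∀ x, D.policyCost Pr ξ π x ≤ D.policyCost Pr ξ π' x

/-! ### The Bellman operator for `Q`-functions -/

/-- `(F q)(x, u) = ℓ(x, u) + γ 𝔼[inf_w q(f(x, u, ξ), w)]`. -/
def Problem.bellmanQ (D : Problem n m) {Ω : Type*} [MeasurableSpace Ω] (Pr : Measure Ω)
    (ξ : Ω → Fin n → ℝ) (q : (Fin n → ℝ) → (Fin m → ℝ) → ℝ) :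
    (Fin n → ℝ) → (Fin m → ℝ) → ℝ :=
  fun x u => D.cost x u + D.γ * ∫ ω, (⨅ w, q (D.dyn x u (ξ ω)) w) ∂Pr

/-- `q` is a measurable fixed point of the Bellman operator, and it is bounded below. The last
condition and the integrability requirement make the infimum and the expectation meaningful. -/
structure Problem.IsFixedPoint (D : Problem n m) {Ω : Type*} [MeasurableSpace Ω] (Pr : Measure Ω)
    (ξ : Ω → Fin n → ℝ) (q : (Fin n → ℝ) → (Fin m → ℝ) → ℝ) : Prop where
  measurable : Measurable (Function.uncurry q)
  bddBelow : ∃ b : ℝ, ∀ x u, b ≤ q x u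
  integrable : ∀ x u, Integrable (fun ω => ⨅ w, q (D.dyn x u (ξ ω)) w) Pr
  fixed : D.bellmanQ Pr ξ q = q

/-- `g` belongs to the space of measurable functions with finite weighted sup-norm
`sup |g(x, u)| / z(x, u)`, for the positive weight `z`. -/
def MemWeighted (z g : (Fin n → ℝ) → (Fin m → ℝ) → ℝ) : Prop :=
  Measurable (Function.uncurry g) ∧
    BddAbove (Set.range fun p : (Fin n → ℝ) × (Fin m → ℝ) => |g p.1 p.2| / z p.1 p.2)

/-- The quadratic weight `1 + |x|² + |u|²`. -/
def quadWeight (x : Fin n → ℝ) (u : Fin m → ℝ) : ℝ := 1 + x ⬝ᵥ x + u ⬝ᵥ u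

/-! ### The augmented Riccati equation -/

/-- The symmetric block matrix `[M a; aᵀ s]`. -/
def augBlock (M : Matrix (Fin n) (Fin n) ℝ) (a : Fin n → ℝ) (s : ℝ) :
    Matrix (Fin n ⊕ Unit) (Fin n ⊕ Unit) ℝ :=
  Matrix.fromBlocks M (Matrix.replicateCol Unit a) (Matrix.replicateRow Unit a)
    (Matrix.of fun _ _ => s)

/-- The block matrix `[N; bᵀ]`. -/
def augRows (N : Matrix (Fin n) (Fin m) ℝ) (b : Fin m → ℝ) :
    Matrix (Fin n ⊕ Unit) (Fin m) ℝ :=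
  Matrix.fromRows N (Matrix.replicateRow Unit b)

/-- `Ã = [A c+μ; 0 1]`. -/
def Problem.augA (D : Problem n m) (μ : Fin n → ℝ) : Matrix (Fin n ⊕ Unit) (Fin n ⊕ Unit) ℝ :=
  Matrix.fromBlocks D.A (Matrix.replicateCol Unit (D.c + μ)) 0 1

/-- `B̃ = [B; 0]`. -/
def Problem.augB (D : Problem n m) : Matrix (Fin n ⊕ Unit) (Fin m) ℝ := augRows D.B 0

/-- `L̃xx = [Lxx Lx; Lxᵀ Lc]`. -/
def Problem.augLxx (D : Problem n m) : Matrix (Fin n ⊕ Unit) (Fin n ⊕ Unit) ℝ :=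
  augBlock D.Lxx D.Lx D.Lc

/-- `L̃xu = [Lxu; Luᵀ]`. -/
def Problem.augLxu (D : Problem n m) : Matrix (Fin n ⊕ Unit) (Fin m) ℝ := augRows D.Lxu D.Lu

/-- The matrix of the stage-cost in augmented coordinates. -/
def Problem.augCost (D : Problem n m) :
    Matrix ((Fin n ⊕ Unit) ⊕ Fin m) ((Fin n ⊕ Unit) ⊕ Fin m) ℝ :=
  Matrix.fromBlocks D.augLxx D.augLxu D.augLxuᵀ D.Luu

/-- `q̃ = L̃xx + γ Ãᵀ P̃ Ã`. -/
def Problem.augq (D : Problem n m) (μ : Fin n → ℝ) (Pt : Matrix (Fin n ⊕ Unit) (Fin n ⊕ Unit) ℝ) :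
    Matrix (Fin n ⊕ Unit) (Fin n ⊕ Unit) ℝ :=
  D.augLxx + D.γ • ((D.augA μ)ᵀ * Pt * D.augA μ)

/-- `q̃_ℓ = L̃xu + γ Ãᵀ P̃ B̃`. -/
def Problem.augql (D : Problem n m) (μ : Fin n → ℝ) (Pt : Matrix (Fin n ⊕ Unit) (Fin n ⊕ Unit) ℝ) :
    Matrix (Fin n ⊕ Unit) (Fin m) ℝ :=
  D.augLxu + D.γ • ((D.augA μ)ᵀ * Pt * D.augB)

/-- `q̃_c = Luu + γ B̃ᵀ P̃ B̃`. -/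
def Problem.augqc (D : Problem n m) (Pt : Matrix (Fin n ⊕ Unit) (Fin n ⊕ Unit) ℝ) :
    Matrix (Fin m) (Fin m) ℝ :=
  D.Luu + D.γ • (D.augBᵀ * Pt * D.augB)

/-- The augmented `Q`-matrix `[q̃ q̃_ℓ; q̃_ℓᵀ q̃_c]`. -/
def Problem.augQ (D : Problem n m) (μ : Fin n → ℝ) (Pt : Matrix (Fin n ⊕ Unit) (Fin n ⊕ Unit) ℝ) :
    Matrix ((Fin n ⊕ Unit) ⊕ Fin m) ((Fin n ⊕ Unit) ⊕ Fin m) ℝ :=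
  Matrix.fromBlocks (D.augq μ Pt) (D.augql μ Pt) (D.augql μ Pt)ᵀ (D.augqc Pt)

/-- `P̃` is a positive semidefinite solution of the augmented algebraic Riccati equation
`P̃ = q̃ - q̃_ℓ q̃_c⁻¹ q̃_ℓᵀ`, with `q̃_c` invertible. -/
def Problem.IsRiccatiSol (D : Problem n m) (μ : Fin n → ℝ)
    (Pt : Matrix (Fin n ⊕ Unit) (Fin n ⊕ Unit) ℝ) : Prop :=
  Pt.PosSemidef ∧ IsUnit (D.augqc Pt).det ∧
    Pt = D.augq μ Pt - D.augql μ Pt * (D.augqc Pt)⁻¹ * (D.augql μ Pt)ᵀ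

end AffineLQ

end

noncomputable section

namespace AffineLQ

open Filter Topology

/-! ### Quadratic forms of matrices -/

/-! In homogeneous coordinates `hom x = [x; 1]` the stage-cost is a quadratic form and the mean
dynamics are linear. Non-negativity of the cost makes its matrix positive semidefinite, and compact
sublevel sets make `Luu` positive definite. Hence `augqc X` is positive definite for every positive
semidefinite `X`, and completing the square (`qf_augQ_eq`) exhibits `ric μ X` as the minimum over
the input and `gain` as its unique minimizer. As a pointwise minimum, `ric` is monotone. Its
iterates from zero increase and stay below every positive semidefinite solution. They are bounded
because a stabilizing feedback has finite discounted cost. Their limit is therefore a solution, and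
the least one.

Centered noise adds only the constant `Tr(P Σ)` to the expectation of a quadratic form
(`integral_qf_hom`). So value iteration from zero is the Riccati iteration together with a scalar
recursion, whose limit is `offset`. Every Bellman fixed point is non-negative and every policy cost
is a limit of policy iterates from zero, so both dominate these value iterates and hence their limit
(`qval_le`, `qval_le_policyCost`). For the policy `gain` with operator `T` and limit value `V`, the
iterates `T^N 0` lie between the value iterates and `V = T^N V`, so they converge to `V`. Thus `V`
is the cost of `gain`, and the tail `γ^N 𝔼 V(x_N) = V - T^N 0` vanishes without any stability of the
closed loop.

This vanishing tail gives uniqueness (`eq_qval`): if a fixed point has `v = inf_w q ≤ C (1 + V)`,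
then `v ≤ T^N (C (1 + V))`, which tends to `V`. If `P` is positive definite, `1 + V` dominates `1 +
|x|²`, so all fixed points of quadratic growth coincide. Any other Riccati solution would produce
one of these, whence uniqueness for the Riccati equation too. -/

/-- The quadratic form `yᵀ X y`. -/
def qf {ι : Type*} [Fintype ι] (X : Matrix ι ι ℝ) (y : ι → ℝ) : ℝ := y ⬝ᵥ (X *ᵥ y)

section QuadraticForm

set_option linter.unusedSectionVars false

variable {ι κ : Type*} [Fintype ι] [Fintype κ]

lemma dotProduct_mulVec_symm {X : Matrix ι ι ℝ} (hX : X.IsSymm) (y z : ι → ℝ) :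
    y ⬝ᵥ (X *ᵥ z) = z ⬝ᵥ (X *ᵥ y) := by
  rw [dotProduct_mulVec, ← mulVec_transpose, hX.eq, dotProduct_comm]

lemma isSymm_of_posSemidef {X : Matrix ι ι ℝ} (hX : X.PosSemidef) : X.IsSymm := by
  have := hX.isHermitian
  rwa [Matrix.IsHermitian, conjTranspose_eq_transpose_of_trivial] at this

lemma posSemidef_iff_qf {X : Matrix ι ι ℝ} : X.PosSemidef ↔ X.IsSymm ∧ ∀ y, 0 ≤ qf X y := by
  rw [posSemidef_iff_dotProduct_mulVec, Matrix.IsHermitian,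
    conjTranspose_eq_transpose_of_trivial]
  simp [qf, Matrix.IsSymm]

lemma posDef_iff_qf {X : Matrix ι ι ℝ} :
    X.PosDef ↔ X.IsSymm ∧ ∀ y, y ≠ 0 → 0 < qf X y := by
  rw [posDef_iff_dotProduct_mulVec, Matrix.IsHermitian,
    conjTranspose_eq_transpose_of_trivial]
  simp [qf, Matrix.IsSymm]

lemma qf_nonneg {X : Matrix ι ι ℝ} (hX : X.PosSemidef) (y : ι → ℝ) : 0 ≤ qf X y :=
  (posSemidef_iff_qf.1 hX).2 y

lemma qf_add_vec {X : Matrix ι ι ℝ} (hX : X.IsSymm) (y z : ι → ℝ) :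
    qf X (y + z) = qf X y + 2 * (y ⬝ᵥ (X *ᵥ z)) + qf X z := by
  simp only [qf, mulVec_add, dotProduct_add, add_dotProduct]
  rw [dotProduct_mulVec_symm hX z y]
  ring

lemma qf_smul_vec (X : Matrix ι ι ℝ) (a : ℝ) (y : ι → ℝ) : qf X (a • y) = a ^ 2 * qf X y := by
  simp only [qf, mulVec_smul, dotProduct_smul, smul_dotProduct, smul_eq_mul]
  ring

@[simp] lemma qf_zero_vec (X : Matrix ι ι ℝ) : qf X 0 = 0 := by simp [qf]

@[simp] lemma qf_zero (y : ι → ℝ) : qf (0 : Matrix ι ι ℝ) y = 0 := by simp [qf]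

lemma qf_add (X Y : Matrix ι ι ℝ) (y : ι → ℝ) : qf (X + Y) y = qf X y + qf Y y := by
  simp [qf, add_mulVec]

lemma qf_sub (X Y : Matrix ι ι ℝ) (y : ι → ℝ) : qf (X - Y) y = qf X y - qf Y y := by
  simp [qf, sub_mulVec]

lemma qf_smul (a : ℝ) (X : Matrix ι ι ℝ) (y : ι → ℝ) : qf (a • X) y = a * qf X y := by
  simp [qf, smul_mulVec]

lemma qf_transpose_mul_mul (C : Matrix κ ι ℝ) (X : Matrix κ κ ℝ) (y : ι → ℝ) :
    qf (Cᵀ * X * C) y = qf X (C *ᵥ y) := by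
  simp only [qf]
  rw [← mulVec_mulVec, ← mulVec_mulVec, dotProduct_mulVec y, vecMul_transpose]

lemma continuous_qf (X : Matrix ι ι ℝ) : Continuous (qf X) := by
  unfold qf dotProduct mulVec dotProduct
  fun_prop

/-- Polarization. -/
lemma apply_eq_qf [DecidableEq ι] {X : Matrix ι ι ℝ} (hX : X.IsSymm) (i j : ι) : X i j =
    (qf X (Pi.single i 1 + Pi.single j 1) - qf X (Pi.single i 1) - qf X (Pi.single j 1)) / 2 := by
  rw [qf_add_vec hX, single_one_dotProduct, mulVec_single_one, col_apply]
  ring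

/-- A symmetric matrix is determined by its quadratic form. -/
lemma eq_of_qf_eq [DecidableEq ι] {X Y : Matrix ι ι ℝ} (hX : X.IsSymm) (hY : Y.IsSymm)
    (h : ∀ y, qf X y = qf Y y) : X = Y := by
  ext i j
  rw [apply_eq_qf hX, apply_eq_qf hY, h, h, h]

lemma qf_fromBlocks (M : Matrix ι ι ℝ) (N : Matrix ι κ ℝ) (R : Matrix κ κ ℝ) (y : ι → ℝ)
    (u : κ → ℝ) : qf (fromBlocks M N Nᵀ R) (Sum.elim y u) =
      qf M y + 2 * (u ⬝ᵥ (Nᵀ *ᵥ y)) + qf R u := by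
  simp only [qf, fromBlocks_mulVec, Sum.elim_comp_inl, Sum.elim_comp_inr,
    sumElim_dotProduct_sumElim, dotProduct_add]
  have : y ⬝ᵥ (N *ᵥ u) = u ⬝ᵥ (Nᵀ *ᵥ y) := by
    rw [dotProduct_mulVec, ← mulVec_transpose, dotProduct_comm]
  rw [this]
  ring

/-- Completion of the square. -/
lemma qf_fromBlocks_eq_schur [DecidableEq κ] (M : Matrix ι ι ℝ) (N : Matrix ι κ ℝ)
    {R : Matrix κ κ ℝ} (hR : R.IsSymm) (hdet : IsUnit R.det) (y : ι → ℝ) (u : κ → ℝ) :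
    qf (fromBlocks M N Nᵀ R) (Sum.elim y u) =
      qf (M - N * R⁻¹ * Nᵀ) y + qf R (u + R⁻¹ *ᵥ (Nᵀ *ᵥ y)) := by
  rw [qf_fromBlocks, qf_add_vec hR, qf_sub]
  have h1 : R *ᵥ (R⁻¹ *ᵥ (Nᵀ *ᵥ y)) = Nᵀ *ᵥ y := by
    rw [mulVec_mulVec, mul_nonsing_inv R hdet, one_mulVec]
  have h2 : qf (N * R⁻¹ * Nᵀ) y = qf R (R⁻¹ *ᵥ (Nᵀ *ᵥ y)) := by
    have := qf_transpose_mul_mul Nᵀ R⁻¹ y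
    rw [transpose_transpose] at this
    rw [this, qf, qf, h1, dotProduct_comm]
  rw [h1, h2]
  ring

lemma isUnit_det_of_posDef [DecidableEq κ] {R : Matrix κ κ ℝ} (hR : R.PosDef) : IsUnit R.det :=
  (Matrix.isUnit_iff_isUnit_det _).1 hR.isUnit

lemma isSymm_schur [DecidableEq κ] {M : Matrix ι ι ℝ} (hM : M.IsSymm) (N : Matrix ι κ ℝ)
    {R : Matrix κ κ ℝ} (hR : R.IsSymm) : (M - N * R⁻¹ * Nᵀ).IsSymm := by
  refine hM.sub ?_
  rw [Matrix.IsSymm, transpose_mul, transpose_mul, transpose_transpose, transpose_nonsing_inv,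
    hR.eq, Matrix.mul_assoc]

lemma abs_qf_le (X : Matrix ι ι ℝ) : ∃ C : ℝ, 0 ≤ C ∧ ∀ y, |qf X y| ≤ C * (y ⬝ᵥ y) := by
  refine ⟨∑ i, ∑ j, |X i j|, by positivity, fun y => ?_⟩
  have hc : ∀ i, y i ^ 2 ≤ y ⬝ᵥ y := fun i => by
    rw [dotProduct, pow_two]
    exact Finset.single_le_sum (f := fun i => y i * y i) (fun j _ => mul_self_nonneg _)
      (Finset.mem_univ i)
  simp only [qf, dotProduct, mulVec, Finset.mul_sum]
  refine (Finset.abs_sum_le_sum_abs _ _).trans ?_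
  rw [← Finset.mul_sum, Finset.sum_mul]
  refine Finset.sum_le_sum fun i _ => ?_
  refine (Finset.abs_sum_le_sum_abs _ _).trans ?_
  rw [Finset.sum_mul]
  refine Finset.sum_le_sum fun j _ => ?_
  have h1 : |y i| * |y j| ≤ y ⬝ᵥ y := by
    have := hc i
    have := hc j
    nlinarith [sq_nonneg (|y i| - |y j|), sq_abs (y i), sq_abs (y j)]
  calc |y i * (X i j * y j)| = |X i j| * (|y i| * |y j|) := by rw [abs_mul, abs_mul]; ring
    _ ≤ |X i j| * (y ⬝ᵥ y) := by gcongr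

/-- A positive definite form dominates a positive multiple of the Euclidean one. -/
lemma exists_le_qf_of_posDef {X : Matrix ι ι ℝ} (hX : X.PosDef) :
    ∃ c : ℝ, 0 < c ∧ ∀ y, c * (y ⬝ᵥ y) ≤ qf X y := by
  have hX' := (posDef_iff_qf.1 hX).2
  have hyy : ∀ y : ι → ℝ, y ≠ 0 → 0 < y ⬝ᵥ y := fun y hy =>
    lt_of_le_of_ne (Finset.sum_nonneg fun i _ => mul_self_nonneg _)
      (fun h => hy (dotProduct_self_eq_zero.1 h.symm))
  have hcont : Continuous fun y : ι → ℝ => y ⬝ᵥ y := by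
    unfold dotProduct; fun_prop
  have hcpt : IsCompact {y : ι → ℝ | y ⬝ᵥ y = 1} := by
    refine Metric.isCompact_of_isClosed_isBounded (isClosed_eq hcont continuous_const) ?_
    refine (Metric.isBounded_closedBall (x := (0 : ι → ℝ)) (r := 1)).subset fun y hy => ?_
    rw [mem_closedBall_zero_iff, pi_norm_le_iff_of_nonneg zero_le_one]
    intro i
    have : y i * y i ≤ y ⬝ᵥ y :=
      Finset.single_le_sum (f := fun i => y i * y i) (fun j _ => mul_self_nonneg _)
        (Finset.mem_univ i)
    rw [Real.norm_eq_abs, abs_le_one_iff_mul_self_le_one]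
    exact this.trans hy.le
  -- The sphere is empty only if zero is the only vector, and then any constant works. Otherwise the
  -- constant is the minimum of the form on the sphere.
  rcases Set.eq_empty_or_nonempty {y : ι → ℝ | y ⬝ᵥ y = 1} with he | hne
  · refine ⟨1, one_pos, fun y => ?_⟩
    by_cases hy : y = 0
    · simp [hy]
    · exfalso
      have h0 := hyy y hy
      have : (Real.sqrt (y ⬝ᵥ y))⁻¹ • y ∈ {y : ι → ℝ | y ⬝ᵥ y = 1} := by
        simp only [Set.mem_ofPred_eq, smul_dotProduct, dotProduct_smul, smul_eq_mul]
        rw [← mul_assoc, ← mul_inv, Real.mul_self_sqrt h0.le, inv_mul_cancel₀ h0.ne']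
      simp [he] at this
  · obtain ⟨z, hz, hmin⟩ := hcpt.exists_isMinOn hne (continuous_qf X).continuousOn
    have hz0 : z ≠ 0 := by
      rintro rfl
      simp at hz
    refine ⟨qf X z, hX' z hz0, fun y => ?_⟩
    by_cases hy : y = 0
    · simp [hy]
    have h0 := hyy y hy
    have hmem : (Real.sqrt (y ⬝ᵥ y))⁻¹ • y ∈ {y : ι → ℝ | y ⬝ᵥ y = 1} := by
      simp only [Set.mem_ofPred_eq, smul_dotProduct, dotProduct_smul, smul_eq_mul]
      rw [← mul_assoc, ← mul_inv, Real.mul_self_sqrt h0.le, inv_mul_cancel₀ h0.ne']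
    have := hmin hmem
    simp only [Set.mem_ofPred_eq] at this
    rw [qf_smul_vec, inv_pow, Real.sq_sqrt h0.le, inv_mul_eq_div, le_div_iff₀ h0] at this
    exact this

/-- Symmetric matrices whose quadratic forms increase and stay bounded converge. -/
lemma exists_tendsto_of_monotone_qf [DecidableEq ι] {X : ℕ → Matrix ι ι ℝ}
    (hs : ∀ k, (X k).IsSymm) (hmono : ∀ y, Monotone fun k => qf (X k) y)
    (hb : ∀ y, BddAbove (Set.range fun k => qf (X k) y)) :
    ∃ Y : Matrix ι ι ℝ, Tendsto X atTop (𝓝 Y) := by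
  have hl : ∀ y, Tendsto (fun k => qf (X k) y) atTop (𝓝 (⨆ k, qf (X k) y)) := fun y =>
    tendsto_atTop_ciSup (hmono y) (hb y)
  refine ⟨Matrix.of fun i j => ((⨆ k, qf (X k) (Pi.single i 1 + Pi.single j 1))
    - (⨆ k, qf (X k) (Pi.single i 1)) - (⨆ k, qf (X k) (Pi.single j 1))) / 2, ?_⟩
  refine tendsto_pi_nhds.2 fun i => tendsto_pi_nhds.2 fun j => ?_
  simp_rw [apply_eq_qf (hs _)]
  exact (((hl _).sub (hl _)).sub (hl _)).div_const 2

lemma tendsto_qf {X : ℕ → Matrix ι ι ℝ} {Y : Matrix ι ι ℝ} (h : Tendsto X atTop (𝓝 Y))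
    (y : ι → ℝ) : Tendsto (fun k => qf (X k) y) atTop (𝓝 (qf Y y)) := by
  have : Continuous fun Z : Matrix ι ι ℝ => qf Z y := by
    unfold qf
    fun_prop
  exact (this.tendsto Y).comp h

end QuadraticForm

/-! ### Powers of Schur stable matrices -/

section Schur

open scoped ENNReal NNReal

attribute [local instance] Matrix.linftyOpNormedRing Matrix.linftyOpNormedAlgebra

/-- Gelfand's formula: `‖M ^ k‖ ^ (1 / k)` tends to the spectral radius, and `r` is any number
strictly between that radius and one. -/
lemma exists_norm_pow_le_of_spectrum {ι : Type*} [Fintype ι] [DecidableEq ι] [Nonempty ι]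
    (M : Matrix ι ι ℂ) (h : ∀ z ∈ spectrum ℂ M, ‖z‖ < 1) :
    ∃ r : ℝ, 0 ≤ r ∧ r < 1 ∧ ∀ᶠ k : ℕ in atTop, ‖M ^ k‖ ≤ r ^ k := by
  have : CompleteSpace (Matrix ι ι ℂ) := FiniteDimensional.complete ℂ _
  have hr : spectralRadius ℂ M < 1 := by
    have := spectrum.spectralRadius_lt_of_forall_lt M (r := 1) (fun z hz => by
      have := h z hz
      rw [← NNReal.coe_lt_coe]
      simpa using this)
    simpa using this
  obtain ⟨r, hr1, hr2⟩ := ENNReal.lt_iff_exists_nnreal_btwn.1 hr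
  refine ⟨r, r.2, by exact_mod_cast hr2, ?_⟩
  have ht := spectrum.pow_nnnorm_pow_one_div_tendsto_nhds_spectralRadius M
  filter_upwards [ht.eventually (gt_mem_nhds hr1), eventually_gt_atTop 0] with k hk hk0
  have hk' : (‖M ^ k‖₊ : ℝ≥0∞) ≤ (r : ℝ≥0∞) ^ k := by
    have h2 := ENNReal.rpow_le_rpow hk.le (z := k) (by positivity)
    rwa [← ENNReal.rpow_mul, one_div, inv_mul_cancel₀ (by positivity), ENNReal.rpow_one,
      ENNReal.rpow_natCast] at h2
  have h3 : ‖M ^ k‖₊ ≤ r ^ k := by exact_mod_cast hk'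
  exact_mod_cast h3

lemma summable_pow_mulVec {ι : Type*} [Fintype ι] [DecidableEq ι] [Nonempty ι]
    (M : Matrix ι ι ℝ) (h : ∀ z ∈ spectrum ℂ (M.map (fun r : ℝ => (r : ℂ))), ‖z‖ < 1)
    (y : ι → ℝ) : Summable fun k : ℕ => (M ^ k *ᵥ y) ⬝ᵥ (M ^ k *ᵥ y) := by
  obtain ⟨r, hr0, hr1, hk⟩ := exists_norm_pow_le_of_spectrum _ h
  have hgeo : Summable fun k : ℕ => (Fintype.card ι : ℝ) * ‖(fun i => (y i : ℂ))‖ ^ 2 *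
      (r ^ 2) ^ k := (summable_geometric_of_lt_one (by positivity) (by nlinarith)).mul_left _
  refine Summable.of_norm_bounded_eventually_nat hgeo ?_
  filter_upwards [hk] with k hk
  have hcoord : ∀ i, |(M ^ k *ᵥ y) i| ≤ r ^ k * ‖(fun i => (y i : ℂ))‖ := by
    intro i
    have h1 : (((M ^ k *ᵥ y) i : ℝ) : ℂ) =
        ((M.map (fun r : ℝ => (r : ℂ))) ^ k *ᵥ (fun i => (y i : ℂ))) i := by
      have h2 : (M.map (fun r : ℝ => (r : ℂ))) ^ k = (M ^ k).map (fun r : ℝ => (r : ℂ)) :=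
        (map_pow (Complex.ofRealHom.mapMatrix) M k).symm
      rw [h2]
      simp [mulVec, dotProduct]
    calc |(M ^ k *ᵥ y) i| = ‖(((M ^ k *ᵥ y) i : ℝ) : ℂ)‖ := by simp
      _ ≤ ‖(M.map (fun r : ℝ => (r : ℂ))) ^ k *ᵥ (fun i => (y i : ℂ))‖ := by
        rw [h1]; exact norm_le_pi_norm _ i
      _ ≤ ‖(M.map (fun r : ℝ => (r : ℂ))) ^ k‖ * ‖(fun i => (y i : ℂ))‖ :=
        Matrix.linfty_opNorm_mulVec _ _
      _ ≤ _ := by gcongr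
  rw [Real.norm_eq_abs, abs_of_nonneg (Finset.sum_nonneg fun i _ => mul_self_nonneg _)]
  calc (M ^ k *ᵥ y) ⬝ᵥ (M ^ k *ᵥ y)
      ≤ ∑ _i : ι, (r ^ k * ‖(fun i => (y i : ℂ))‖) ^ 2 := by
        refine Finset.sum_le_sum fun i _ => ?_
        rw [← pow_two, ← sq_abs]
        have := hcoord i
        gcongr
    _ = _ := by
        rw [Finset.sum_const, Finset.card_univ, nsmul_eq_mul]
        ring

end Schur

/-! ### The augmented linear-quadratic problem -/

variable {n m : ℕ}

/-- The standing assumptions on the problem data. -/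
structure Problem.Regular (D : Problem n m) : Prop where
  γ_pos : 0 < D.γ
  γ_lt : D.γ < 1
  stab : IsStabilizable (Real.sqrt D.γ • D.A) (Real.sqrt D.γ • D.B)
  symm_xx : D.Lxx.IsSymm
  symm_uu : D.Luu.IsSymm
  cost_nonneg : ∀ x u, 0 ≤ D.cost x u
  compact : ∀ (x : Fin n → ℝ) (r : ℝ), IsCompact {u : Fin m → ℝ | D.cost x u ≤ r}

/-- The homogeneous coordinates `[x; 1]`. -/
def hom (x : Fin n → ℝ) : Fin n ⊕ Unit → ℝ := Sum.elim x fun _ => 1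

lemma qf_augBlock (M : Matrix (Fin n) (Fin n) ℝ) (a : Fin n → ℝ) (s : ℝ) (x : Fin n → ℝ) :
    qf (augBlock M a s) (hom x) = qf M x + 2 * (x ⬝ᵥ a) + s := by
  have h := qf_fromBlocks M (replicateCol Unit a) (Matrix.of fun _ _ : Unit => s) x fun _ => 1
  rw [transpose_replicateCol] at h
  rw [augBlock, hom, h]
  simp [qf, mulVec, dotProduct, mul_comm]

lemma isSymm_augBlock {M : Matrix (Fin n) (Fin n) ℝ} (hM : M.IsSymm) (a : Fin n → ℝ) (s : ℝ) :
    (augBlock M a s).IsSymm :=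
  hM.fromBlocks (by simp) (by ext; simp)

lemma exists_eq_augBlock {X : Matrix (Fin n ⊕ Unit) (Fin n ⊕ Unit) ℝ} (hX : X.IsSymm) :
    X = augBlock X.toBlocks₁₁ (fun i => X (Sum.inl i) (Sum.inr ())) (X (Sum.inr ()) (Sum.inr ())) := by
  ext i j
  rcases i with i | i <;> rcases j with j | j <;> simp [augBlock, toBlocks₁₁]
  exact hX.apply _ _

lemma augRows_transpose_mulVec (N : Matrix (Fin n) (Fin m) ℝ) (b : Fin m → ℝ) (x : Fin n → ℝ) :
    (augRows N b)ᵀ *ᵥ hom x = Nᵀ *ᵥ x + b := by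
  ext i
  simp [augRows, hom, mulVec, dotProduct, Matrix.transpose_apply]

lemma qf_augBlock_fromBlocks (M : Matrix (Fin n) (Fin n) ℝ) (N : Matrix (Fin n) (Fin m) ℝ)
    (R : Matrix (Fin m) (Fin m) ℝ) (a : Fin n → ℝ) (b : Fin m → ℝ) (s : ℝ)
    (x : Fin n → ℝ) (u : Fin m → ℝ) :
    qf (fromBlocks (augBlock M a s) (augRows N b) (augRows N b)ᵀ R) (Sum.elim (hom x) u) =
      genQuad M N R a b s x u := by
  have h := qf_fromBlocks M N R x u
  rw [qf_fromBlocks, qf_augBlock, augRows_transpose_mulVec, genQuad, ← qf, h,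
    sumElim_dotProduct_sumElim, dotProduct_add]
  ring

lemma Problem.cost_eq (D : Problem n m) (x : Fin n → ℝ) (u : Fin m → ℝ) :
    D.cost x u = qf D.augCost (Sum.elim (hom x) u) :=
  (qf_augBlock_fromBlocks _ _ _ _ _ _ _ _).symm

lemma Problem.Regular.isSymm_augLxx {D : Problem n m} (hD : D.Regular) : D.augLxx.IsSymm :=
  isSymm_augBlock hD.symm_xx _ _

lemma Problem.Regular.isSymm_augCost {D : Problem n m} (hD : D.Regular) : D.augCost.IsSymm :=
  hD.isSymm_augLxx.fromBlocks rfl hD.symm_uu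

/-- The cost controls the form only where the last homogeneous coordinate is one. Scaling extends
this to all vectors with nonzero last coordinate, and a small shift of that coordinate, with
continuity, covers the rest. -/
lemma Problem.Regular.augCost_posSemidef {D : Problem n m} (hD : D.Regular) :
    D.augCost.PosSemidef := by
  refine posSemidef_iff_qf.2 ⟨hD.isSymm_augCost, fun y => ?_⟩
  have hne : ∀ z : (Fin n ⊕ Unit) ⊕ Fin m → ℝ, z (Sum.inl (Sum.inr ())) ≠ 0 →
      0 ≤ qf D.augCost z := by
    intro z hz
    have h := hD.cost_nonneg (fun i => (z (Sum.inl (Sum.inr ())))⁻¹ * z (Sum.inl (Sum.inl i)))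
      (fun i => (z (Sum.inl (Sum.inr ())))⁻¹ * z (Sum.inr i))
    have hz' : z = z (Sum.inl (Sum.inr ())) • Sum.elim
        (hom fun i => (z (Sum.inl (Sum.inr ())))⁻¹ * z (Sum.inl (Sum.inl i)))
        (fun i => (z (Sum.inl (Sum.inr ())))⁻¹ * z (Sum.inr i)) := by
      ext i
      rcases i with (i | i) | i <;> simp [hom, hz]
    rw [D.cost_eq] at h
    rw [hz', qf_smul_vec]
    positivity
  by_cases hy : y (Sum.inl (Sum.inr ())) = 0
  · have hlim : Tendsto (fun t : ℝ => qf D.augCost (y + t • Pi.single (Sum.inl (Sum.inr ())) 1))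
        (𝓝[≠] 0) (𝓝 (qf D.augCost y)) := by
      have hc : Continuous fun t : ℝ =>
          qf D.augCost (y + t • Pi.single (Sum.inl (Sum.inr ())) 1) :=
        (continuous_qf _).comp (by fun_prop)
      have := hc.tendsto 0
      simp only [zero_smul, add_zero] at this
      exact this.mono_left nhdsWithin_le_nhds
    refine ge_of_tendsto hlim ?_
    filter_upwards [self_mem_nhdsWithin] with t ht
    refine hne _ ?_
    simpa [hy] using ht
  · exact hne y hy

/-- Along a null direction of `Luu` the cost at `x = 0` is affine. Being non-negative it is
constant, so a sublevel set contains a whole line and is not compact. -/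
lemma Problem.Regular.luu_posDef {D : Problem n m} (hD : D.Regular) : D.Luu.PosDef := by
  have hpsd : ∀ u, 0 ≤ qf D.Luu u := fun u => by
    have h := qf_nonneg hD.augCost_posSemidef (Sum.elim 0 u)
    rw [Problem.augCost, qf_fromBlocks] at h
    simpa using h
  refine posDef_iff_qf.2 ⟨hD.symm_uu, fun v hv => lt_of_le_of_ne (hpsd v) fun h0 => ?_⟩
  have hform : ∀ t : ℝ, D.cost 0 (t • v) = D.Lc + 2 * t * (v ⬝ᵥ D.Lu) := by
    intro t
    rw [D.cost_eq, Problem.augCost, qf_fromBlocks, Problem.augLxx, qf_augBlock, Problem.augLxu,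
      augRows_transpose_mulVec, qf_smul_vec, ← h0]
    simp
    ring
  have hlin : v ⬝ᵥ D.Lu = 0 := by
    by_contra hne
    -- This multiple of `v` is chosen so that the affine cost equals `-1`.
    have h := hD.cost_nonneg 0 ((-(D.Lc + 1) / (2 * (v ⬝ᵥ D.Lu))) • v)
    rw [hform] at h
    have : 2 * (-(D.Lc + 1) / (2 * (v ⬝ᵥ D.Lu))) * (v ⬝ᵥ D.Lu) = -(D.Lc + 1) := by
      field_simp
    linarith
  obtain ⟨C, hC⟩ := (hD.compact 0 D.Lc).isBounded.exists_norm_le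
  have hv' : 0 < ‖v‖ := norm_pos_iff.2 hv
  have := hC (((|C| + 1) / ‖v‖) • v) (by simp [hform, hlin])
  rw [norm_smul, Real.norm_eq_abs, abs_of_nonneg (by positivity), div_mul_cancel₀ _ hv'.ne'] at this
  linarith [le_abs_self C]

/-- The next augmented state `Ã y + B̃ u` for zero noise. -/
def Problem.augNext (D : Problem n m) (μ : Fin n → ℝ) (y : Fin n ⊕ Unit → ℝ) (u : Fin m → ℝ) :
    Fin n ⊕ Unit → ℝ := D.augA μ *ᵥ y + D.augB *ᵥ u

lemma Problem.augNext_hom (D : Problem n m) (μ x : Fin n → ℝ) (u : Fin m → ℝ) :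
    D.augNext μ (hom x) u = hom (D.dyn x u μ) := by
  ext i
  rcases i with i | i
  · simp [Problem.augNext, Problem.augA, Problem.augB, augRows, hom, Problem.dyn, mulVec,
      dotProduct]
    ring
  · simp [Problem.augNext, Problem.augA, Problem.augB, augRows, hom, mulVec, dotProduct]

/-! ### The Riccati operator and its iteration from zero -/

section Riccati

variable {D : Problem n m} {μ : Fin n → ℝ} {X Y : Matrix (Fin n ⊕ Unit) (Fin n ⊕ Unit) ℝ}

/-- `augQ` is the cost matrix plus `γ` times the pullback of `X` under `[Ã B̃]`; this is what gives
it the form of a one-step lookahead. -/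
lemma Problem.qf_augQ (D : Problem n m) (μ : Fin n → ℝ) (hX : X.IsSymm) (y : Fin n ⊕ Unit → ℝ)
    (u : Fin m → ℝ) : qf (D.augQ μ X) (Sum.elim y u) =
      qf D.augCost (Sum.elim y u) + D.γ * qf X (D.augNext μ y u) := by
  have h : D.augQ μ X = D.augCost +
      D.γ • ((fromCols (D.augA μ) D.augB)ᵀ * X * fromCols (D.augA μ) D.augB) := by
    rw [transpose_fromCols, fromRows_mul, fromRows_mul_fromCols, Problem.augCost, fromBlocks_smul,
      fromBlocks_add, Problem.augQ, Problem.augq, Problem.augql, Problem.augqc]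
    congr 1
    rw [transpose_add, transpose_smul, transpose_mul, transpose_mul, hX.eq, transpose_transpose,
      Matrix.mul_assoc]
  rw [h, qf_add, qf_smul, qf_transpose_mul_mul, fromCols_mulVec_sumElim, Problem.augNext]

lemma Problem.Regular.augqc_posDef (hD : D.Regular) (hX : X.PosSemidef) :
    (D.augqc X).PosDef := by
  refine hD.luu_posDef.add_posSemidef (PosSemidef.smul ?_ hD.γ_pos.le)
  have := hX.conjTranspose_mul_mul_same D.augB
  rwa [conjTranspose_eq_transpose_of_trivial] at this

/-- The right-hand side of the augmented Riccati equation. -/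
def Problem.ric (D : Problem n m) (μ : Fin n → ℝ) (X : Matrix (Fin n ⊕ Unit) (Fin n ⊕ Unit) ℝ) :
    Matrix (Fin n ⊕ Unit) (Fin n ⊕ Unit) ℝ :=
  D.augq μ X - D.augql μ X * (D.augqc X)⁻¹ * (D.augql μ X)ᵀ

/-- The minimizing input. -/
def Problem.gain (D : Problem n m) (μ : Fin n → ℝ) (X : Matrix (Fin n ⊕ Unit) (Fin n ⊕ Unit) ℝ)
    (y : Fin n ⊕ Unit → ℝ) : Fin m → ℝ :=
  -((D.augqc X)⁻¹ *ᵥ ((D.augql μ X)ᵀ *ᵥ y))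

lemma Problem.Regular.qf_augQ_eq (hD : D.Regular) (hX : X.PosSemidef) (y : Fin n ⊕ Unit → ℝ)
    (u : Fin m → ℝ) : qf (D.augQ μ X) (Sum.elim y u) =
      qf (D.ric μ X) y + qf (D.augqc X) (u - D.gain μ X y) := by
  have h := hD.augqc_posDef hX
  rw [Problem.gain, sub_neg_eq_add, Problem.augQ,
    qf_fromBlocks_eq_schur _ _ (isSymm_of_posSemidef h.posSemidef) (isUnit_det_of_posDef h)]
  rfl

lemma Problem.Regular.qf_ric_le (hD : D.Regular) (hX : X.PosSemidef) (y : Fin n ⊕ Unit → ℝ)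
    (u : Fin m → ℝ) : qf (D.ric μ X) y ≤
      qf D.augCost (Sum.elim y u) + D.γ * qf X (D.augNext μ y u) := by
  rw [← D.qf_augQ μ (isSymm_of_posSemidef hX), hD.qf_augQ_eq hX]
  exact le_add_of_nonneg_right (qf_nonneg (hD.augqc_posDef hX).posSemidef _)

lemma Problem.Regular.qf_ric_eq (hD : D.Regular) (hX : X.PosSemidef) (y : Fin n ⊕ Unit → ℝ) :
    qf (D.ric μ X) y = qf D.augCost (Sum.elim y (D.gain μ X y)) +
      D.γ * qf X (D.augNext μ y (D.gain μ X y)) := by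
  rw [← D.qf_augQ μ (isSymm_of_posSemidef hX), hD.qf_augQ_eq hX, sub_self, qf_zero_vec, add_zero]

lemma Problem.Regular.isSymm_augq (hD : D.Regular) (hX : X.IsSymm) : (D.augq μ X).IsSymm := by
  refine hD.isSymm_augLxx.add (IsSymm.smul ?_ _)
  rw [Matrix.IsSymm, transpose_mul, transpose_mul, transpose_transpose, hX.eq, Matrix.mul_assoc]

lemma Problem.Regular.ric_posSemidef (hD : D.Regular) (hX : X.PosSemidef) :
    (D.ric μ X).PosSemidef := by
  refine posSemidef_iff_qf.2 ⟨isSymm_schur (hD.isSymm_augq (isSymm_of_posSemidef hX)) _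
    (isSymm_of_posSemidef (hD.augqc_posDef hX).posSemidef), fun y => ?_⟩
  rw [hD.qf_ric_eq hX]
  exact add_nonneg (qf_nonneg hD.augCost_posSemidef _)
    (mul_nonneg hD.γ_pos.le (qf_nonneg hX _))

/-- The minimizing input for `Y` is an admissible, possibly suboptimal, input for `X`. -/
lemma Problem.Regular.ric_mono (hD : D.Regular) (hX : X.PosSemidef) (hY : Y.PosSemidef)
    (h : ∀ y, qf X y ≤ qf Y y) (y : Fin n ⊕ Unit → ℝ) :
    qf (D.ric μ X) y ≤ qf (D.ric μ Y) y := by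
  rw [hD.qf_ric_eq hY]
  refine (hD.qf_ric_le hX y (D.gain μ Y y)).trans ?_
  have := hD.γ_pos.le
  gcongr
  exact h _

lemma Problem.Regular.isRiccatiSol_iff (hD : D.Regular) :
    D.IsRiccatiSol μ X ↔ X.PosSemidef ∧ X = D.ric μ X :=
  ⟨fun h => ⟨h.1, h.2.2⟩, fun h => ⟨h.1, isUnit_det_of_posDef (hD.augqc_posDef h.1), h.2⟩⟩

/-- The Riccati iteration started at zero. -/
def Problem.ricIter (D : Problem n m) (μ : Fin n → ℝ) :
    ℕ → Matrix (Fin n ⊕ Unit) (Fin n ⊕ Unit) ℝ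
  | 0 => 0
  | k + 1 => D.ric μ (D.ricIter μ k)

lemma Problem.Regular.ricIter_posSemidef (hD : D.Regular) (k : ℕ) :
    (D.ricIter μ k).PosSemidef := by
  induction k with
  | zero => exact PosSemidef.zero
  | succ k ih => exact hD.ric_posSemidef ih

lemma Problem.Regular.ricIter_mono (hD : D.Regular) (y : Fin n ⊕ Unit → ℝ) :
    Monotone fun k => qf (D.ricIter μ k) y := by
  refine monotone_nat_of_le_succ fun k => ?_
  induction k generalizing y with
  | zero =>
    rw [show D.ricIter μ 0 = 0 from rfl, qf_zero]
    exact qf_nonneg (hD.ricIter_posSemidef 1) y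
  | succ k ih =>
    exact hD.ric_mono (hD.ricIter_posSemidef k) (hD.ricIter_posSemidef (k + 1)) ih y

lemma Problem.Regular.ricIter_le (hD : D.Regular) (hX : D.IsRiccatiSol μ X) (k : ℕ)
    (y : Fin n ⊕ Unit → ℝ) : qf (D.ricIter μ k) y ≤ qf X y := by
  obtain ⟨h1, h2⟩ := hD.isRiccatiSol_iff.1 hX
  induction k generalizing y with
  | zero =>
    rw [show D.ricIter μ 0 = 0 from rfl, qf_zero]
    exact qf_nonneg h1 y
  | succ k ih =>
    rw [h2]
    exact hD.ric_mono (hD.ricIter_posSemidef k) h1 ih y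

/-- Each iterate is an optimal finite-horizon cost, hence at most the cost of a fixed stabilizing
feedback, which is summable by `summable_pow_mulVec`. -/
lemma Problem.Regular.bddAbove_ricIter (hD : D.Regular) (y : Fin n ⊕ Unit → ℝ) :
    BddAbove (Set.range fun k => qf (D.ricIter μ k) y) := by
  obtain ⟨K, hK⟩ := hD.stab
  -- The factor `√γ` is absorbed into the closed-loop matrix, since `γ * qf X (M z) = qf X ((r • M)
  -- z)`.
  set r := Real.sqrt D.γ with hr
  have hrr : r ^ 2 = D.γ := Real.sq_sqrt hD.γ_pos.le
  have hr0 : 0 ≤ r := Real.sqrt_nonneg _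
  have hr1 : r < 1 := by nlinarith [hD.γ_lt]
  set Kt : Matrix (Fin m) (Fin n ⊕ Unit) ℝ := fromCols K 0 with hKt
  set M : Matrix (Fin n ⊕ Unit) (Fin n ⊕ Unit) ℝ := D.augA μ + D.augB * Kt with hM
  have hrM : r • M = fromBlocks (r • D.A + r • D.B * K) (r • replicateCol Unit (D.c + μ)) 0
      (r • (1 : Matrix Unit Unit ℝ)) := by
    rw [hM, hKt, Problem.augB, augRows, fromRows_mul_fromCols, Problem.augA, fromBlocks_add,
      fromBlocks_smul, smul_add, smul_mul]
    simp
  -- The scaled closed loop is block triangular: its eigenvalues are those of the stabilized block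
  -- and `√γ < 1`, which belongs to the constant coordinate.
  have hspec : ∀ z ∈ spectrum ℂ ((r • M).map (fun r : ℝ => (r : ℂ))), ‖z‖ < 1 := by
    intro z hz
    by_contra hz1
    have h1 : z ∉ spectrum ℂ ((r • D.A + r • D.B * K).map (fun r : ℝ => (r : ℂ))) :=
      fun h => hz1 (hK z h)
    have h2 : z - (r : ℂ) ≠ 0 := by
      intro h
      rw [sub_eq_zero.1 h] at hz1
      exact hz1 (by simpa [abs_of_nonneg hr0] using hr1)
    rw [spectrum.notMem_iff, Matrix.isUnit_iff_isUnit_det] at h1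
    refine spectrum.notMem_iff.2 ?_ hz
    have hblock : algebraMap ℂ (Matrix (Fin n ⊕ Unit) (Fin n ⊕ Unit) ℂ) z -
        (r • M).map (fun r : ℝ => (r : ℂ)) = fromBlocks
          (algebraMap ℂ _ z - (r • D.A + r • D.B * K).map (fun r : ℝ => (r : ℂ)))
          (-(r • replicateCol Unit (D.c + μ)).map (fun r : ℝ => (r : ℂ))) 0
          (Matrix.of fun _ _ => z - (r : ℂ)) := by
      rw [hrM, fromBlocks_map]
      ext i j
      rcases i with i | i <;> rcases j with j | j <;>
        simp [Matrix.algebraMap_matrix_apply]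
    rw [hblock, Matrix.isUnit_iff_isUnit_det, det_fromBlocks_zero₂₁]
    refine h1.mul ?_
    rw [det_unique]
    exact isUnit_iff_ne_zero.2 h2
  have hcl : ∀ z, D.augNext μ z (Kt *ᵥ z) = M *ᵥ z := fun z => by
    rw [Problem.augNext, hM, add_mulVec, mulVec_mulVec]
  obtain ⟨C, hC0, hC⟩ := abs_qf_le D.augCost
  obtain ⟨C', hC'0, hC'⟩ := abs_qf_le (Ktᵀ * (1 : Matrix (Fin m) (Fin m) ℝ) * Kt)
  have hstage : ∀ z, qf D.augCost (Sum.elim z (Kt *ᵥ z)) ≤ C * (1 + C') * (z ⬝ᵥ z) := by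
    intro z
    refine (le_abs_self _).trans ((hC _).trans ?_)
    have h3 := (le_abs_self _).trans (hC' z)
    rw [qf_transpose_mul_mul, qf, one_mulVec] at h3
    rw [sumElim_dotProduct_sumElim, mul_assoc]
    gcongr
    linarith
  have hbound : ∀ k z, qf (D.ricIter μ k) z ≤
      ∑ j ∈ Finset.range k, C * (1 + C') * (((r • M) ^ j *ᵥ z) ⬝ᵥ ((r • M) ^ j *ᵥ z)) := by
    intro k
    induction k with
    | zero => intro z; simp [Problem.ricIter]
    | succ k ih =>
      intro z
      refine (hD.qf_ric_le (hD.ricIter_posSemidef k) z (Kt *ᵥ z)).trans ?_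
      rw [Finset.sum_range_succ', hcl, add_comm]
      refine add_le_add ?_ (by simpa using hstage z)
      rw [← hrr, ← qf_smul_vec, ← smul_mulVec]
      refine (ih _).trans (le_of_eq (Finset.sum_congr rfl fun j _ => ?_))
      rw [mulVec_mulVec, ← pow_succ]
  have hsum := (summable_pow_mulVec (r • M) hspec y).mul_left (C * (1 + C'))
  refine ⟨_, Set.forall_mem_range.2 fun k => (hbound k y).trans (hsum.sum_le_tsum _ fun j _ => ?_)⟩
  have : 0 ≤ ((r • M) ^ j *ᵥ y) ⬝ᵥ ((r • M) ^ j *ᵥ y) :=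
    Finset.sum_nonneg fun i _ => mul_self_nonneg _
  positivity

/-- The least positive semidefinite solution of the Riccati equation, as the limit of the Riccati
iteration. -/
lemma Problem.Regular.exists_riccatiSol (hD : D.Regular) (μ : Fin n → ℝ) :
    ∃ X, D.IsRiccatiSol μ X ∧ Tendsto (D.ricIter μ) atTop (𝓝 X) := by
  obtain ⟨X, hX⟩ := exists_tendsto_of_monotone_qf
    (fun k => isSymm_of_posSemidef (hD.ricIter_posSemidef (μ := μ) k)) hD.ricIter_mono
    hD.bddAbove_ricIter
  have hpsd : X.PosSemidef := by
    refine posSemidef_iff_qf.2 ⟨?_, fun y => ge_of_tendsto' (tendsto_qf hX y) fun k =>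
      qf_nonneg (hD.ricIter_posSemidef k) y⟩
    refine tendsto_nhds_unique ((continuous_id.matrix_transpose.tendsto X).comp hX) ?_
    refine hX.congr fun k => ?_
    exact (isSymm_of_posSemidef (hD.ricIter_posSemidef (μ := μ) k)).eq.symm
  refine ⟨X, hD.isRiccatiSol_iff.2 ⟨hpsd, tendsto_nhds_unique (hX.comp (tendsto_add_atTop_nat 1)) ?_⟩,
    hX⟩
  have hq : Continuous fun Z => D.augq μ Z := by unfold Problem.augq; fun_prop
  have hql : Continuous fun Z => D.augql μ Z := by unfold Problem.augql; fun_prop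
  have hqc : Continuous fun Z => D.augqc Z := by unfold Problem.augqc; fun_prop
  -- The inverse is the adjugate divided by the determinant, which is nonzero at the limit because
  -- `augqc X` is positive definite.
  have hinv : ContinuousAt (fun Z => (D.augqc Z)⁻¹) X := by
    simp_rw [Matrix.inv_def, Ring.inverse_eq_inv']
    refine ContinuousAt.smul (ContinuousAt.inv₀ hqc.matrix_det.continuousAt ?_)
      hqc.matrix_adjugate.continuousAt
    exact (isUnit_det_of_posDef (hD.augqc_posDef hpsd)).ne_zero
  have hric : ContinuousAt (D.ric μ) X := by
    have hF : Continuous fun p : Matrix (Fin n ⊕ Unit) (Fin n ⊕ Unit) ℝ ×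
        Matrix (Fin n ⊕ Unit) (Fin m) ℝ × Matrix (Fin m) (Fin m) ℝ =>
        p.1 - p.2.1 * p.2.2 * p.2.1ᵀ := by fun_prop
    exact hF.continuousAt.comp (hq.continuousAt.prodMk (hql.continuousAt.prodMk hinv))
  exact hric.tendsto.comp hX

end Riccati

/-! ### Expectation of a quadratic function of the next state -/

section Noise

variable {n m : ℕ} {Ω : Type*} [MeasurableSpace Ω] {Pr : Measure Ω} {e : Ω → Fin n → ℝ}

/-- The quadratic form at `y` is the variance of the scalar `y ⬝ᵥ e`. -/
lemma covMat_posSemidef [IsProbabilityMeasure Pr] (he : MemLp e 2 Pr) :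
    (covMat Pr e).PosSemidef := by
  have hd : ∀ i, MemLp (fun ω => e ω i - meanVec Pr e i) 2 Pr := fun i =>
    (he.eval i).sub (memLp_const _)
  have hdd : ∀ i j, Integrable
      (fun ω => (e ω i - meanVec Pr e i) * (e ω j - meanVec Pr e j)) Pr := fun i j =>
    (hd i).integrable_mul (hd j)
  refine posSemidef_iff_qf.2 ⟨by ext i j; exact covariance_comm _ _, fun y => ?_⟩
  have h : qf (covMat Pr e) y = ∫ ω, (∑ i, y i * (e ω i - meanVec Pr e i)) ^ 2 ∂Pr := by
    have : ∀ ω, (∑ i, y i * (e ω i - meanVec Pr e i)) ^ 2 = ∑ i, ∑ j, y i * y j *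
        ((e ω i - meanVec Pr e i) * (e ω j - meanVec Pr e j)) := fun ω => by
      rw [pow_two, Finset.sum_mul_sum]
      exact Finset.sum_congr rfl fun i _ => Finset.sum_congr rfl fun j _ => by ring
    simp_rw [this]
    rw [integral_finsetSum _ fun i _ => integrable_finsetSum _ fun j _ =>
      (hdd i j).const_mul _]
    simp only [qf, dotProduct, mulVec, Finset.mul_sum]
    refine Finset.sum_congr rfl fun i _ => ?_
    rw [integral_finsetSum _ fun j _ => (hdd i j).const_mul _]
    refine Finset.sum_congr rfl fun j _ => ?_
    rw [integral_const_mul]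
    simp only [covMat, of_apply, covariance, meanVec]
    ring
  rw [h]
  exact integral_nonneg fun ω => sq_nonneg _

/-- Expand around the mean: the linear term integrates to zero, and since noise leaves the constant
coordinate fixed, the second-order term sees only the upper-left block. -/
lemma integral_qf_hom [IsProbabilityMeasure Pr] (he : MemLp e 2 Pr)
    {X : Matrix (Fin n ⊕ Unit) (Fin n ⊕ Unit) ℝ} (hX : X.IsSymm) (a : Fin n → ℝ) :
    Integrable (fun ω => qf X (hom (a + e ω))) Pr ∧
      ∫ ω, qf X (hom (a + e ω)) ∂Pr =
        qf X (hom (a + meanVec Pr e)) + (X.toBlocks₁₁ * covMat Pr e).trace := by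
  have hi : ∀ i, Integrable (fun ω => e ω i) Pr := fun i => (he.eval i).integrable one_le_two
  have hd : ∀ i, MemLp (fun ω => e ω i - meanVec Pr e i) 2 Pr := fun i =>
    (he.eval i).sub (memLp_const _)
  have hdd : ∀ i j, Integrable
      (fun ω => (e ω i - meanVec Pr e i) * (e ω j - meanVec Pr e j)) Pr := fun i j =>
    (hd i).integrable_mul (hd j)
  have hdi : ∀ i, Integrable (fun ω => e ω i - meanVec Pr e i) Pr := fun i =>
    (hd i).integrable one_le_two
  have hd0 : ∀ i, ∫ ω, (e ω i - meanVec Pr e i) ∂Pr = 0 := fun i => by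
    rw [integral_sub (hi i) (integrable_const _)]
    simp [meanVec]
  set M := X.toBlocks₁₁ with hM
  set w := hom (a + meanVec Pr e) with hw
  have hform : ∀ ω, qf X (hom (a + e ω)) = qf X w +
      (2 * ∑ i, (e ω i - meanVec Pr e i) * (X *ᵥ w) (Sum.inl i) +
      ∑ i, ∑ j, M i j * ((e ω i - meanVec Pr e i) * (e ω j - meanVec Pr e j))) := by
    intro ω
    have h1 : hom (a + e ω) = w + Sum.elim (e ω - meanVec Pr e) 0 := by
      ext i
      rcases i with i | i <;> simp [hw, hom]
    have h2 : w ⬝ᵥ (X *ᵥ Sum.elim (e ω - meanVec Pr e) 0) =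
        ∑ i, (e ω i - meanVec Pr e i) * (X *ᵥ w) (Sum.inl i) := by
      rw [dotProduct_mulVec_symm hX]
      simp [dotProduct]
    have h3 : qf X (Sum.elim (e ω - meanVec Pr e) 0) =
        ∑ i, ∑ j, M i j * ((e ω i - meanVec Pr e i) * (e ω j - meanVec Pr e j)) := by
      simp only [qf, dotProduct, mulVec, Fintype.sum_sum_type]
      simp only [Sum.elim_inl, Sum.elim_inr, Pi.zero_apply, mul_zero, zero_mul,
        Finset.sum_const_zero, add_zero, Pi.sub_apply, Finset.mul_sum]
      exact Finset.sum_congr rfl fun i _ => Finset.sum_congr rfl fun j _ => by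
        simp [hM, toBlocks₁₁]; ring
    rw [h1, qf_add_vec hX, h2, h3]
    ring
  have hi1 : Integrable (fun ω => 2 * ∑ i, (e ω i - meanVec Pr e i) * (X *ᵥ w) (Sum.inl i)) Pr :=
    (integrable_finsetSum _ fun i _ => (hdi i).mul_const _).const_mul _
  have hi2 : ∀ i, Integrable (fun ω => ∑ j, M i j *
      ((e ω i - meanVec Pr e i) * (e ω j - meanVec Pr e j))) Pr := fun i =>
    integrable_finsetSum _ fun j _ => (hdd i j).const_mul _
  have hi3 : Integrable (fun ω => ∑ i, ∑ j, M i j *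
      ((e ω i - meanVec Pr e i) * (e ω j - meanVec Pr e j))) Pr :=
    integrable_finsetSum _ fun i _ => hi2 i
  have hi13 : Integrable (fun ω => 2 * ∑ i, (e ω i - meanVec Pr e i) * (X *ᵥ w) (Sum.inl i) +
      ∑ i, ∑ j, M i j * ((e ω i - meanVec Pr e i) * (e ω j - meanVec Pr e j))) Pr := hi1.add hi3
  simp_rw [hform]
  refine ⟨(integrable_const _).add hi13, ?_⟩
  rw [integral_add (integrable_const _) hi13, integral_add hi1 hi3, integral_const_mul,
    integral_finsetSum _ fun i _ => (hdi i).mul_const _, integral_finsetSum _ fun i _ => hi2 i]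
  simp_rw [integral_mul_const, hd0]
  have htr : (M * covMat Pr e).trace = ∑ i, ∫ ω, ∑ j, M i j *
      ((e ω i - meanVec Pr e i) * (e ω j - meanVec Pr e j)) ∂Pr := by
    simp only [trace, diag_apply, mul_apply]
    refine Finset.sum_congr rfl fun i _ => ?_
    rw [integral_finsetSum _ fun j _ => (hdd i j).const_mul _]
    refine Finset.sum_congr rfl fun j _ => ?_
    rw [integral_const_mul, covMat, of_apply, covariance_comm]
    rfl
  rw [htr]
  simp

/-- With `M = Rᴴ * R` the trace is that of the positive semidefinite matrix `R * S * Rᴴ`. -/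
lemma trace_mul_nonneg {M S : Matrix (Fin n) (Fin n) ℝ} (hM : M.PosSemidef) (hS : S.PosSemidef) :
    0 ≤ (M * S).trace := by
  obtain ⟨R, hR⟩ : ∃ R : Matrix (Fin n) (Fin n) ℝ, M = Rᴴ * R := by
    open scoped MatrixOrder in
    obtain ⟨R, hR⟩ := CStarAlgebra.nonneg_iff_eq_star_mul_self.1 hM.nonneg
    exact ⟨R, hR⟩
  rw [hR, Matrix.mul_assoc, Matrix.trace_mul_comm]
  exact (hS.mul_mul_conjTranspose_same R).trace_nonneg

/-- The quadratic function `x ↦ [x; 1]ᵀ X [x; 1] + s`. -/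
def val (X : Matrix (Fin n ⊕ Unit) (Fin n ⊕ Unit) ℝ) (s : ℝ) (x : Fin n → ℝ) : ℝ :=
  qf X (hom x) + s

lemma continuous_val (X : Matrix (Fin n ⊕ Unit) (Fin n ⊕ Unit) ℝ) (s : ℝ) :
    Continuous (val X s) := by
  have : Continuous (hom : (Fin n → ℝ) → _) := by
    refine continuous_pi fun i => ?_
    rcases i with i | i
    · exact continuous_apply i
    · exact continuous_const
  exact ((continuous_qf X).comp this).add continuous_const

/-- The `Q`-function with stage-cost, followed by the terminal cost `val X s`. -/
def Problem.qval (D : Problem n m) (μ : Fin n → ℝ) (S : Matrix (Fin n) (Fin n) ℝ)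
    (X : Matrix (Fin n ⊕ Unit) (Fin n ⊕ Unit) ℝ) (s : ℝ) (x : Fin n → ℝ) (u : Fin m → ℝ) : ℝ :=
  qf (D.augQ μ X) (Sum.elim (hom x) u) + D.γ * (s + (X.toBlocks₁₁ * S).trace)

lemma Problem.dyn_eq (D : Problem n m) (x : Fin n → ℝ) (u : Fin m → ℝ) (w : Fin n → ℝ) :
    D.dyn x u w = (D.A *ᵥ x + D.B *ᵥ u + D.c) + w := rfl

lemma Problem.integrable_val (D : Problem n m) [IsProbabilityMeasure Pr] (he : MemLp e 2 Pr)
    {X : Matrix (Fin n ⊕ Unit) (Fin n ⊕ Unit) ℝ} (hX : X.IsSymm) (s : ℝ) (x : Fin n → ℝ)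
    (u : Fin m → ℝ) : Integrable (fun ω => val X s (D.dyn x u (e ω))) Pr :=
  (integral_qf_hom he hX _).1.add (integrable_const s)

lemma Problem.qval_eq (D : Problem n m) [IsProbabilityMeasure Pr] (he : MemLp e 2 Pr)
    {X : Matrix (Fin n ⊕ Unit) (Fin n ⊕ Unit) ℝ} (hX : X.IsSymm) (s : ℝ) (x : Fin n → ℝ)
    (u : Fin m → ℝ) : D.qval (meanVec Pr e) (covMat Pr e) X s x u =
      D.cost x u + D.γ * ∫ ω, val X s (D.dyn x u (e ω)) ∂Pr := by
  have h : ∫ ω, val X s (D.dyn x u (e ω)) ∂Pr = qf X (hom (D.dyn x u (meanVec Pr e))) +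
      (X.toBlocks₁₁ * covMat Pr e).trace + s := by
    simp only [val, D.dyn_eq]
    rw [integral_add (integral_qf_hom he hX _).1 (integrable_const s), (integral_qf_hom he hX _).2]
    simp
  rw [h, Problem.qval, D.qf_augQ _ hX, D.augNext_hom, D.cost_eq]
  ring

end Noise

/-! ### Controlled Markov chains -/

section Markov

open scoped ENNReal

variable {n m : ℕ} {Ω : Type*} [MeasurableSpace Ω] {Pr : Measure Ω}

lemma Problem.measurable_dyn {α : Type*} [MeasurableSpace α] (D : Problem n m)
    {x : α → Fin n → ℝ} {u : α → Fin m → ℝ} {w : α → Fin n → ℝ} (hx : Measurable x)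
    (hu : Measurable u) (hw : Measurable w) : Measurable fun a => D.dyn (x a) (u a) (w a) := by
  have hA : Continuous fun y : Fin n → ℝ => D.A *ᵥ y := by fun_prop
  have hB : Continuous fun y : Fin m → ℝ => D.B *ᵥ y := by fun_prop
  exact (((hA.measurable.comp hx).add (hB.measurable.comp hu)).add_const D.c).add hw

lemma Problem.measurable_cost (D : Problem n m) :
    Measurable fun p : (Fin n → ℝ) × (Fin m → ℝ) => D.cost p.1 p.2 := by
  have : Continuous fun p : (Fin n → ℝ) × (Fin m → ℝ) => Sum.elim p.1 p.2 := by
    refine continuous_pi fun i => ?_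
    rcases i with i | i
    · exact (continuous_apply i).comp continuous_fst
    · exact (continuous_apply i).comp continuous_snd
  unfold Problem.cost genQuad
  exact Continuous.measurable (by fun_prop)

/-- The transition operator `h ↦ 𝔼[h(f(·, π(·), e))]`. -/
def Problem.trans (D : Problem n m) (Pr : Measure Ω) (e : Ω → Fin n → ℝ)
    (π : (Fin n → ℝ) → (Fin m → ℝ)) (h : (Fin n → ℝ) → ℝ≥0∞) (x : Fin n → ℝ) : ℝ≥0∞ :=
  ∫⁻ ω, h (D.dyn x (π x) (e ω)) ∂Pr

/-- The stage-cost under a policy. -/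
def Problem.stage (D : Problem n m) (π : (Fin n → ℝ) → (Fin m → ℝ)) (x : Fin n → ℝ) : ℝ≥0∞ :=
  ENNReal.ofReal (D.cost x (π x))

/-- The Bellman operator of a policy. -/
def Problem.policyOp (D : Problem n m) (Pr : Measure Ω) (e : Ω → Fin n → ℝ)
    (π : (Fin n → ℝ) → (Fin m → ℝ)) (g : (Fin n → ℝ) → ℝ≥0∞) (x : Fin n → ℝ) : ℝ≥0∞ :=
  D.stage π x + ENNReal.ofReal D.γ * D.trans Pr e π g x

variable (D : Problem n m) {e : Ω → Fin n → ℝ} {ξ : ℕ → Ω → Fin n → ℝ}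
  {π : (Fin n → ℝ) → (Fin m → ℝ)} {g h : (Fin n → ℝ) → ℝ≥0∞}

lemma Problem.measurable_stage (hπ : Measurable π) : Measurable (D.stage π) :=
  (D.measurable_cost.comp (measurable_id.prodMk hπ)).ennreal_ofReal

lemma Problem.measurable_next (hπ : Measurable π) :
    Measurable fun p : (Fin n → ℝ) × (Fin n → ℝ) => D.dyn p.1 (π p.1) p.2 :=
  D.measurable_dyn measurable_fst (hπ.comp measurable_fst) measurable_snd

lemma Problem.measurable_trans [SFinite Pr] (he : Measurable e) (hπ : Measurable π)
    (hh : Measurable h) : Measurable (D.trans Pr e π h) :=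
  Measurable.lintegral_prod_right' (f := fun p : (Fin n → ℝ) × Ω => h (D.dyn p.1 (π p.1) (e p.2)))
    (hh.comp (D.measurable_dyn measurable_fst (hπ.comp measurable_fst) (he.comp measurable_snd)))

lemma Problem.measurable_trans_section (he : Measurable e)
    (hh : Measurable h) (x : Fin n → ℝ) : Measurable fun ω => h (D.dyn x (π x) (e ω)) :=
  hh.comp (D.measurable_dyn measurable_const measurable_const he)

lemma Problem.iterate_trans_add [SFinite Pr] (he : Measurable e) (hπ : Measurable π)
    (hg : Measurable g) (hh : Measurable h) (k : ℕ) :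
    (D.trans Pr e π)^[k] (g + h) = (D.trans Pr e π)^[k] g + (D.trans Pr e π)^[k] h := by
  induction k generalizing g h with
  | zero => rfl
  | succ k ih =>
    have : D.trans Pr e π (g + h) = D.trans Pr e π g + D.trans Pr e π h := by
      ext x
      exact lintegral_add_left (D.measurable_trans_section he hg x) _
    rw [Function.iterate_succ_apply, this, ih (D.measurable_trans he hπ hg)
      (D.measurable_trans he hπ hh)]
    rfl

lemma Problem.iterate_trans_smul [SFinite Pr] (he : Measurable e) (hπ : Measurable π)
    (hg : Measurable g) (c : ℝ≥0∞) (k : ℕ) :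
    (D.trans Pr e π)^[k] (c • g) = c • (D.trans Pr e π)^[k] g := by
  induction k generalizing g with
  | zero => rfl
  | succ k ih =>
    have : D.trans Pr e π (c • g) = c • D.trans Pr e π g := by
      ext x
      exact lintegral_const_mul _ (D.measurable_trans_section he hg x)
    rw [Function.iterate_succ_apply, this, ih (D.measurable_trans he hπ hg)]
    rfl

lemma Problem.iterate_trans_one [IsProbabilityMeasure Pr] (k : ℕ) :
    (D.trans Pr e π)^[k] 1 = 1 := by
  refine Function.iterate_fixed ?_ k
  ext x
  simp [Problem.trans]

lemma Problem.policyOp_mono (hgh : ∀ x, g x ≤ h x) (x : Fin n → ℝ) :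
    D.policyOp Pr e π g x ≤ D.policyOp Pr e π h x := by
  unfold Problem.policyOp Problem.trans
  gcongr
  exact hgh _

/-- The iterate is the `N`-stage cost with terminal cost `g`. Separating the running costs from the
terminal term is what later isolates the tail. -/
lemma Problem.iterate_policyOp [SFinite Pr] (he : Measurable e) (hπ : Measurable π)
    (hg : Measurable g) (N : ℕ) (x : Fin n → ℝ) :
    (D.policyOp Pr e π)^[N] g x =
      ∑ k ∈ Finset.range N, ENNReal.ofReal D.γ ^ k * (D.trans Pr e π)^[k] (D.stage π) x +
        ENNReal.ofReal D.γ ^ N * (D.trans Pr e π)^[N] g x := by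
  induction N generalizing g with
  | zero => simp
  | succ N ih =>
    have hop : D.policyOp Pr e π g = D.stage π + ENNReal.ofReal D.γ • D.trans Pr e π g := rfl
    have hs := D.measurable_stage hπ
    have ht := D.measurable_trans (Pr := Pr) he hπ hg
    rw [Function.iterate_succ_apply, ih (hop ▸ hs.add (ht.const_smul _)), hop,
      D.iterate_trans_add he hπ hs (ht.const_smul _), D.iterate_trans_smul he hπ ht,
      Finset.sum_range_succ, Function.iterate_succ_apply]
    simp only [Pi.add_apply, Pi.smul_apply, smul_eq_mul]
    ring

-- The state at time `k` depends only on the noise before time `k`; this is the source of its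
-- independence from `ξ k`.
omit [MeasurableSpace Ω] in
lemma Problem.exists_traj_eq (hπ : Measurable π) (x : Fin n → ℝ) (k : ℕ) :
    ∃ F : (Finset.range k → Fin n → ℝ) → Fin n → ℝ, Measurable F ∧
      ∀ (ξ : ℕ → Ω → Fin n → ℝ) ω, D.traj ξ π x k ω = F fun i => ξ i ω := by
  induction k with
  | zero => exact ⟨fun _ => x, measurable_const, fun _ _ => rfl⟩
  | succ k ih =>
    obtain ⟨F, hF, h⟩ := ih
    let r : (Finset.range (k + 1) → Fin n → ℝ) → (Finset.range k → Fin n → ℝ) := fun z i =>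
      z ⟨i, Finset.range_subset_range.2 k.le_succ i.2⟩
    have hr : Measurable r := measurable_pi_lambda _ fun i => measurable_pi_apply _
    refine ⟨fun z => D.dyn (F (r z)) (π (F (r z))) (z ⟨k, Finset.self_mem_range_succ k⟩),
      D.measurable_dyn (hF.comp hr) (hπ.comp (hF.comp hr)) (measurable_pi_apply _), fun ξ ω => ?_⟩
    rw [Problem.traj, h]

lemma Problem.measurable_traj (hξ : ∀ k, Measurable (ξ k)) (hπ : Measurable π) (x : Fin n → ℝ)
    (k : ℕ) : Measurable (D.traj ξ π x k) := by
  induction k with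
  | zero => exact measurable_const
  | succ k ih => exact D.measurable_dyn ih (hπ.comp ih) (hξ k)

variable [IsProbabilityMeasure Pr]

/-- The Markov property: independence makes the joint law of state and noise a product, identical
distribution replaces `ξ k` by `ξ 0`, and Tonelli peels off the last transition. -/
lemma Problem.lintegral_traj (hξ : ∀ k, Measurable (ξ k)) (hindep : iIndepFun ξ Pr)
    (hident : ∀ k, IdentDistrib (ξ k) (ξ 0) Pr Pr) (hπ : Measurable π) (x : Fin n → ℝ) (k : ℕ)
    (hh : Measurable h) :
    ∫⁻ ω, h (D.traj ξ π x k ω) ∂Pr = (D.trans Pr (ξ 0) π)^[k] h x := by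
  induction k generalizing h with
  | zero => simp [Problem.traj]
  | succ k ih =>
    rw [Function.iterate_succ_apply, ← ih (D.measurable_trans (hξ 0) hπ hh)]
    have hind : IndepFun (D.traj ξ π x k) (ξ k) Pr := by
      obtain ⟨F, hF, hFeq⟩ := D.exists_traj_eq (Ω := Ω) hπ x k
      have h1 := hindep.indepFun_finset (Finset.range k) {k} (by simp) hξ
      have h2 := h1.comp hF (measurable_pi_apply (⟨k, Finset.mem_singleton_self k⟩ : ({k} : Finset ℕ)))
      have h3 : D.traj ξ π x k = F ∘ fun ω (i : Finset.range k) => ξ i ω := by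
        ext1 ω; exact hFeq ξ ω
      rw [h3]
      exact h2
    have hx := D.measurable_traj hξ hπ x k
    have hm : Measurable fun p : (Fin n → ℝ) × (Fin n → ℝ) => h (D.dyn p.1 (π p.1) p.2) :=
      hh.comp (D.measurable_next hπ)
    calc ∫⁻ ω, h (D.traj ξ π x (k + 1) ω) ∂Pr
        = ∫⁻ p, h (D.dyn p.1 (π p.1) p.2) ∂(Pr.map fun ω => (D.traj ξ π x k ω, ξ k ω)) := by
          rw [lintegral_map hm (hx.prodMk (hξ k))]
          rfl
      _ = ∫⁻ a, ∫⁻ b, h (D.dyn a (π a) b) ∂(Pr.map (ξ 0)) ∂(Pr.map (D.traj ξ π x k)) := by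
          have := Measure.isProbabilityMeasure_map (μ := Pr) (hξ 0).aemeasurable
          rw [hind.map_prod_eq_prod_map_map hx.aemeasurable (hξ k).aemeasurable,
            (hident k).map_eq, lintegral_prod _ hm.aemeasurable]
      _ = ∫⁻ a, D.trans Pr (ξ 0) π h a ∂(Pr.map (D.traj ξ π x k)) := by
          refine lintegral_congr fun a => ?_
          have ha : Measurable fun b => h (D.dyn a (π a) b) :=
            hh.comp (D.measurable_dyn measurable_const measurable_const measurable_id)
          rw [lintegral_map ha (hξ 0), Problem.trans]
      _ = _ := lintegral_map (D.measurable_trans (hξ 0) hπ hh) hx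

lemma Problem.policyCost_eq (hγ : 0 ≤ D.γ) (hξ : ∀ k, Measurable (ξ k)) (hindep : iIndepFun ξ Pr)
    (hident : ∀ k, IdentDistrib (ξ k) (ξ 0) Pr Pr) (hπ : Measurable π) (x : Fin n → ℝ) :
    D.policyCost Pr ξ π x =
      ∑' k, ENNReal.ofReal D.γ ^ k * (D.trans Pr (ξ 0) π)^[k] (D.stage π) x := by
  have hs := D.measurable_stage hπ
  have heq : ∀ k ω, ENNReal.ofReal (D.γ ^ k * D.cost (D.traj ξ π x k ω) (π (D.traj ξ π x k ω))) =
      ENNReal.ofReal D.γ ^ k * D.stage π (D.traj ξ π x k ω) := fun k ω => by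
    rw [ENNReal.ofReal_mul (pow_nonneg hγ k), ENNReal.ofReal_pow hγ]
    rfl
  unfold Problem.policyCost
  simp_rw [heq]
  have hm : ∀ k, Measurable fun ω => D.stage π (D.traj ξ π x k ω) := fun k =>
    hs.comp (D.measurable_traj hξ hπ x k)
  rw [lintegral_tsum fun k => ((hm k).const_mul _).aemeasurable]
  refine tsum_congr fun k => ?_
  rw [lintegral_const_mul _ (hm k), D.lintegral_traj hξ hindep hident hπ x k hs]

lemma Problem.tendsto_policyCost (hγ : 0 ≤ D.γ) (hξ : ∀ k, Measurable (ξ k))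
    (hindep : iIndepFun ξ Pr) (hident : ∀ k, IdentDistrib (ξ k) (ξ 0) Pr Pr) (hπ : Measurable π)
    (x : Fin n → ℝ) : Tendsto (fun N => (D.policyOp Pr (ξ 0) π)^[N] 0 x) atTop
      (𝓝 (D.policyCost Pr ξ π x)) := by
  rw [D.policyCost_eq hγ hξ hindep hident hπ]
  refine ENNReal.summable.hasSum.tendsto_sum_nat.congr fun N => ?_
  have h0 : (D.trans Pr (ξ 0) π)^[N] 0 = 0 :=
    Function.iterate_fixed (by ext x; simp [Problem.trans]) N
  rw [D.iterate_policyOp (hξ 0) hπ measurable_zero, h0]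
  simp

lemma Problem.iterate_policyOp_zero_le (hγ : 0 ≤ D.γ) (hξ : ∀ k, Measurable (ξ k))
    (hindep : iIndepFun ξ Pr) (hident : ∀ k, IdentDistrib (ξ k) (ξ 0) Pr Pr) (hπ : Measurable π)
    (x : Fin n → ℝ) (N : ℕ) :
    (D.policyOp Pr (ξ 0) π)^[N] 0 x ≤ D.policyCost Pr ξ π x := by
  refine Monotone.ge_of_tendsto (f := fun N => (D.policyOp Pr (ξ 0) π)^[N] 0 x) ?_
    (D.tendsto_policyCost hγ hξ hindep hident hπ x) N
  refine monotone_nat_of_le_succ fun k => ?_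
  induction k generalizing x with
  | zero => exact zero_le
  | succ k ih =>
    rw [Function.iterate_succ_apply', Function.iterate_succ_apply']
    exact D.policyOp_mono ih x

end Markov

/-! ### Value iteration and policy evaluation -/

section Bellman

open scoped ENNReal

variable {n m : ℕ} {D : Problem n m} {X Y : Matrix (Fin n ⊕ Unit) (Fin n ⊕ Unit) ℝ}
  {μ : Fin n → ℝ} {S : Matrix (Fin n) (Fin n) ℝ}

lemma Problem.Regular.qval_eq_val_ric (hD : D.Regular) (hX : X.PosSemidef) (s : ℝ)
    (x : Fin n → ℝ) (u : Fin m → ℝ) : D.qval μ S X s x u =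
      val (D.ric μ X) (D.γ * (s + (X.toBlocks₁₁ * S).trace)) x +
        qf (D.augqc X) (u - D.gain μ X (hom x)) := by
  rw [Problem.qval, hD.qf_augQ_eq hX, val]
  ring

lemma Problem.Regular.val_ric_le (hD : D.Regular) (hX : X.PosSemidef) (s : ℝ)
    (x : Fin n → ℝ) (u : Fin m → ℝ) :
    val (D.ric μ X) (D.γ * (s + (X.toBlocks₁₁ * S).trace)) x ≤ D.qval μ S X s x u := by
  rw [hD.qval_eq_val_ric hX]
  exact le_add_of_nonneg_right (qf_nonneg (hD.augqc_posDef hX).posSemidef _)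

/-- The contribution `γ Tr(P Σ) / (1 - γ)` of the noise to the optimal value. -/
def Problem.offset (D : Problem n m) (S : Matrix (Fin n) (Fin n) ℝ)
    (X : Matrix (Fin n ⊕ Unit) (Fin n ⊕ Unit) ℝ) : ℝ :=
  D.γ * (X.toBlocks₁₁ * S).trace / (1 - D.γ)

lemma Problem.Regular.offset_eq (hD : D.Regular) :
    D.γ * (D.offset S X + (X.toBlocks₁₁ * S).trace) = D.offset S X := by
  have : 1 - D.γ ≠ 0 := by linarith [hD.γ_lt]
  unfold Problem.offset
  field_simp
  ring

lemma toBlocks₁₁_posSemidef (hX : X.PosSemidef) : X.toBlocks₁₁.PosSemidef := hX.submatrix Sum.inl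

lemma Problem.Regular.offset_nonneg (hD : D.Regular) (hX : X.PosSemidef) (hS : S.PosSemidef) :
    0 ≤ D.offset S X := by
  have h1 := trace_mul_nonneg (toBlocks₁₁_posSemidef hX) hS
  have h2 := hD.γ_pos
  have h3 : 0 < 1 - D.γ := by linarith [hD.γ_lt]
  unfold Problem.offset
  positivity

lemma val_nonneg (hX : X.PosSemidef) {s : ℝ} (hs : 0 ≤ s) (x : Fin n → ℝ) : 0 ≤ val X s x :=
  add_nonneg (qf_nonneg hX _) hs

lemma Problem.Regular.qval_eq_val (hD : D.Regular) (hX : D.IsRiccatiSol μ X) (x : Fin n → ℝ)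
    (u : Fin m → ℝ) : D.qval μ S X (D.offset S X) x u =
      val X (D.offset S X) x + qf (D.augqc X) (u - D.gain μ X (hom x)) := by
  obtain ⟨h1, h2⟩ := hD.isRiccatiSol_iff.1 hX
  rw [hD.qval_eq_val_ric h1, hD.offset_eq, ← h2]

lemma Problem.Regular.val_le_qval (hD : D.Regular) (hX : D.IsRiccatiSol μ X) (x : Fin n → ℝ)
    (u : Fin m → ℝ) : val X (D.offset S X) x ≤ D.qval μ S X (D.offset S X) x u := by
  rw [hD.qval_eq_val hX]
  exact le_add_of_nonneg_right (qf_nonneg (hD.augqc_posDef hX.1).posSemidef _)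

lemma Problem.Regular.qval_gain (hD : D.Regular) (hX : D.IsRiccatiSol μ X) (x : Fin n → ℝ) :
    D.qval μ S X (D.offset S X) x (D.gain μ X (hom x)) = val X (D.offset S X) x := by
  rw [hD.qval_eq_val hX, sub_self, qf_zero_vec, add_zero]

lemma Problem.Regular.qval_nonneg (hD : D.Regular) (hX : D.IsRiccatiSol μ X)
    (hS : S.PosSemidef) (x : Fin n → ℝ) (u : Fin m → ℝ) :
    0 ≤ D.qval μ S X (D.offset S X) x u :=
  (val_nonneg hX.1 (hD.offset_nonneg hX.1 hS) x).trans (hD.val_le_qval hX x u)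

lemma Problem.Regular.iInf_qval (hD : D.Regular) (hX : D.IsRiccatiSol μ X) (x : Fin n → ℝ) :
    ⨅ w, D.qval μ S X (D.offset S X) x w = val X (D.offset S X) x := by
  refine le_antisymm ?_ (le_ciInf fun w => hD.val_le_qval hX x w)
  rw [← hD.qval_gain hX x]
  exact ciInf_le ⟨_, Set.forall_mem_range.2 fun w => hD.val_le_qval hX x w⟩ _

lemma Problem.Regular.qval_le_val_iff (hD : D.Regular) (hX : D.IsRiccatiSol μ X) (x : Fin n → ℝ)
    (u : Fin m → ℝ) : D.qval μ S X (D.offset S X) x u ≤ val X (D.offset S X) x ↔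
      u = D.gain μ X (hom x) := by
  rw [hD.qval_eq_val hX]
  constructor
  · intro h
    by_contra hne
    have := (posDef_iff_qf.1 (hD.augqc_posDef hX.1)).2 _ (sub_ne_zero.2 hne)
    linarith
  · rintro rfl
    simp

lemma Problem.continuous_qval (D : Problem n m) (s : ℝ) :
    Continuous (Function.uncurry (D.qval μ S X s)) := by
  have : Continuous fun p : (Fin n → ℝ) × (Fin m → ℝ) => Sum.elim (hom p.1) p.2 := by
    refine continuous_pi fun i => ?_
    rcases i with (i | i) | i
    · exact (continuous_apply i).comp continuous_fst
    · exact continuous_const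
    · exact (continuous_apply i).comp continuous_snd
  exact ((continuous_qf _).comp this).add continuous_const

/-- The constant terms of value iteration. -/
def Problem.offIter (D : Problem n m) (μ : Fin n → ℝ) (S : Matrix (Fin n) (Fin n) ℝ) : ℕ → ℝ
  | 0 => 0
  | k + 1 => D.γ * (D.offIter μ S k + ((D.ricIter μ k).toBlocks₁₁ * S).trace)

lemma trace_mul_mono (hS : S.PosSemidef) (hX : X.IsSymm) (hY : Y.IsSymm)
    (h : ∀ y, qf X y ≤ qf Y y) :
    (X.toBlocks₁₁ * S).trace ≤ (Y.toBlocks₁₁ * S).trace := by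
  have hYX : (Y - X).PosSemidef := posSemidef_iff_qf.2 ⟨hY.sub hX, fun y => by
    rw [qf_sub]
    exact sub_nonneg.2 (h y)⟩
  have := trace_mul_nonneg (toBlocks₁₁_posSemidef hYX) hS
  rw [show (Y - X).toBlocks₁₁ = Y.toBlocks₁₁ - X.toBlocks₁₁ from rfl, Matrix.sub_mul,
    trace_sub] at this
  linarith

lemma Problem.Regular.offIter_nonneg (hD : D.Regular) (hS : S.PosSemidef) (k : ℕ) :
    0 ≤ D.offIter μ S k := by
  induction k with
  | zero => exact le_rfl
  | succ k ih =>
    exact mul_nonneg hD.γ_pos.le (add_nonneg ih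
      (trace_mul_nonneg (toBlocks₁₁_posSemidef (hD.ricIter_posSemidef k)) hS))

/-- The constants increase and are bounded by `offset`; their limit solves `s = γ (s + Tr(P Σ))`,
which has one solution because `γ < 1`. -/
lemma Problem.Regular.tendsto_offIter (hD : D.Regular) (hS : S.PosSemidef)
    (hX : D.IsRiccatiSol μ X) (hlim : Tendsto (D.ricIter μ) atTop (𝓝 X)) :
    Tendsto (D.offIter μ S) atTop (𝓝 (D.offset S X)) := by
  have hsymm := fun k => isSymm_of_posSemidef (hD.ricIter_posSemidef (μ := μ) k)
  have hmono : Monotone (D.offIter μ S) := by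
    refine monotone_nat_of_le_succ fun k => ?_
    induction k with
    | zero => exact hD.offIter_nonneg hS 1
    | succ k ih =>
      exact mul_le_mul_of_nonneg_left (add_le_add ih (trace_mul_mono hS (hsymm k) (hsymm (k + 1))
        fun y => hD.ricIter_mono y k.le_succ)) hD.γ_pos.le
  have hb : ∀ k, D.offIter μ S k ≤ D.offset S X := by
    intro k
    induction k with
    | zero => exact hD.offset_nonneg hX.1 hS
    | succ k ih =>
      rw [← hD.offset_eq]
      exact mul_le_mul_of_nonneg_left (add_le_add ih (trace_mul_mono hS (hsymm k)
        (isSymm_of_posSemidef hX.1) (hD.ricIter_le hX k))) hD.γ_pos.le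
  have hL := tendsto_atTop_ciSup hmono ⟨_, Set.forall_mem_range.2 hb⟩
  have htr : Tendsto (fun k => ((D.ricIter μ k).toBlocks₁₁ * S).trace) atTop
      (𝓝 (X.toBlocks₁₁ * S).trace) := by
    have : Continuous fun Z : Matrix (Fin n ⊕ Unit) (Fin n ⊕ Unit) ℝ =>
        (Z.toBlocks₁₁ * S).trace :=
      ((continuous_id.matrix_submatrix Sum.inl Sum.inl).matrix_mul continuous_const).matrix_trace
    exact (this.tendsto X).comp hlim
  have hrec := tendsto_nhds_unique (hL.comp (tendsto_add_atTop_nat 1))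
    ((hL.add htr).const_mul D.γ)
  have : 1 - D.γ ≠ 0 := by linarith [hD.γ_lt]
  have hLeq : (⨆ k, D.offIter μ S k) = D.offset S X := by
    unfold Problem.offset
    field_simp
    linarith
  rwa [hLeq] at hL

lemma Problem.Regular.tendsto_qval (hD : D.Regular) (hS : S.PosSemidef)
    (hX : D.IsRiccatiSol μ X) (hlim : Tendsto (D.ricIter μ) atTop (𝓝 X)) (x : Fin n → ℝ)
    (u : Fin m → ℝ) :
    Tendsto (fun k => D.qval μ S (D.ricIter μ k) (D.offIter μ S k) x u) atTop
      (𝓝 (D.qval μ S X (D.offset S X) x u)) := by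
  -- Shifted by one, because the constant in the `k`-th `Q`-function is already `offIter (k + 1)`.
  have h1 := (hD.tendsto_offIter hS hX hlim).comp (tendsto_add_atTop_nat 1)
  have h2 : ∀ Z : Matrix (Fin n ⊕ Unit) (Fin n ⊕ Unit) ℝ, Z.IsSymm → ∀ s,
      D.qval μ S Z s x u = qf D.augCost (Sum.elim (hom x) u) +
        D.γ * qf Z (D.augNext μ (hom x) u) + D.γ * (s + (Z.toBlocks₁₁ * S).trace) := by
    intro Z hZ s
    rw [Problem.qval, D.qf_augQ μ hZ]
  rw [h2 X (isSymm_of_posSemidef hX.1), hD.offset_eq]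
  simp_rw [fun k => h2 _ (isSymm_of_posSemidef (hD.ricIter_posSemidef (μ := μ) k))
    (D.offIter μ S k)]
  exact (tendsto_const_nhds.add ((tendsto_qf hlim _).const_mul _)).add h1

variable {Ω : Type*} [MeasurableSpace Ω] {Pr : Measure Ω} [IsProbabilityMeasure Pr]
  {e : Ω → Fin n → ℝ} {π : (Fin n → ℝ) → (Fin m → ℝ)}

/-- A solution of the Riccati equation yields a fixed point of the Bellman operator. -/
lemma Problem.Regular.isFixedPoint_qval (hD : D.Regular) (he : MemLp e 2 Pr)
    (hX : D.IsRiccatiSol (meanVec Pr e) X) :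
    D.IsFixedPoint Pr e (D.qval (meanVec Pr e) (covMat Pr e) X (D.offset (covMat Pr e) X)) where
  measurable := (D.continuous_qval _).measurable
  bddBelow := ⟨0, hD.qval_nonneg hX (covMat_posSemidef he)⟩
  integrable x u := by
    simp_rw [hD.iInf_qval hX]
    exact D.integrable_val he (isSymm_of_posSemidef hX.1) _ x u
  fixed := by
    ext x u
    rw [Problem.bellmanQ]
    simp_rw [hD.iInf_qval hX]
    rw [D.qval_eq he (isSymm_of_posSemidef hX.1)]

lemma Problem.Regular.policyOp_val (hD : D.Regular) (he : MemLp e 2 Pr) (hX : X.PosSemidef)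
    {s : ℝ} (hs : 0 ≤ s) (x : Fin n → ℝ) :
    D.policyOp Pr e π (fun y => ENNReal.ofReal (val X s y)) x =
      ENNReal.ofReal (D.qval (meanVec Pr e) (covMat Pr e) X s x (π x)) := by
  have hnn : ∀ ω, 0 ≤ val X s (D.dyn x (π x) (e ω)) := fun ω => val_nonneg hX hs _
  rw [D.qval_eq he (isSymm_of_posSemidef hX), ENNReal.ofReal_add (hD.cost_nonneg _ _)
    (mul_nonneg hD.γ_pos.le (integral_nonneg hnn)), ENNReal.ofReal_mul hD.γ_pos.le,
    ofReal_integral_eq_lintegral_ofReal (D.integrable_val he (isSymm_of_posSemidef hX) s x (π x))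
      (ae_of_all _ hnn)]
  rfl

omit [IsProbabilityMeasure Pr] in
lemma Problem.monotone_policyOp (D : Problem n m) : Monotone (D.policyOp Pr e π) :=
  fun _ _ h x => D.policyOp_mono h x

/-- Keep the first input `π x` and optimize the `k` later ones: the result cannot exceed the cost of
`π` over `k + 1` stages with zero terminal cost. -/
lemma Problem.Regular.qval_ricIter_le (hD : D.Regular) (he : MemLp e 2 Pr) (k : ℕ)
    (x : Fin n → ℝ) :
    ENNReal.ofReal (D.qval (meanVec Pr e) (covMat Pr e) (D.ricIter (meanVec Pr e) k)
      (D.offIter (meanVec Pr e) (covMat Pr e) k) x (π x)) ≤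
      (D.policyOp Pr e π)^[k + 1] 0 x := by
  have hS := covMat_posSemidef he
  have hval : ∀ k x, ENNReal.ofReal (val (D.ricIter (meanVec Pr e) k)
      (D.offIter (meanVec Pr e) (covMat Pr e) k) x) ≤ (D.policyOp Pr e π)^[k] 0 x := by
    intro k
    induction k with
    | zero =>
      intro x
      simp [val, Problem.ricIter, Problem.offIter]
    | succ k ih =>
      intro x
      rw [Function.iterate_succ_apply']
      refine le_trans ?_ (D.policyOp_mono ih x)
      rw [hD.policyOp_val he (hD.ricIter_posSemidef k) (hD.offIter_nonneg hS k)]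
      exact ENNReal.ofReal_le_ofReal (hD.val_ric_le (hD.ricIter_posSemidef k) _ x (π x))
  rw [Function.iterate_succ_apply', ← hD.policyOp_val he (hD.ricIter_posSemidef k)
    (hD.offIter_nonneg hS k)]
  exact D.policyOp_mono (hval k) x

/-- The optimal policy is a fixed point of its policy operator. -/
lemma Problem.Regular.policyOp_gain (hD : D.Regular) (he : MemLp e 2 Pr)
    (hX : D.IsRiccatiSol (meanVec Pr e) X) :
    D.policyOp Pr e (fun x => D.gain (meanVec Pr e) X (hom x))
      (fun y => ENNReal.ofReal (val X (D.offset (covMat Pr e) X) y)) =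
      fun y => ENNReal.ofReal (val X (D.offset (covMat Pr e) X) y) := by
  ext x
  rw [hD.policyOp_val he hX.1 (hD.offset_nonneg hX.1 (covMat_posSemidef he)), hD.qval_gain hX]

/-- A squeeze: value iteration bounds the iterates from below, and monotonicity with the fixed point
`val` bounds them from above. -/
lemma Problem.Regular.tendsto_iterate_policyOp_gain (hD : D.Regular) (he : MemLp e 2 Pr)
    (hX : D.IsRiccatiSol (meanVec Pr e) X)
    (hlim : Tendsto (D.ricIter (meanVec Pr e)) atTop (𝓝 X)) (x : Fin n → ℝ) :
    Tendsto (fun N => (D.policyOp Pr e fun x => D.gain (meanVec Pr e) X (hom x))^[N] 0 x) atTop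
      (𝓝 (ENNReal.ofReal (val X (D.offset (covMat Pr e) X) x))) := by
  rw [← tendsto_add_atTop_iff_nat 1]
  have h1 := ENNReal.tendsto_ofReal (hD.tendsto_qval (covMat_posSemidef he) hX hlim x
    (D.gain (meanVec Pr e) X (hom x)))
  rw [hD.qval_gain hX] at h1
  refine tendsto_of_tendsto_of_tendsto_of_le_of_le h1 tendsto_const_nhds
    (fun k => hD.qval_ricIter_le he k x) fun k => ?_
  have := ((D.monotone_policyOp (Pr := Pr) (e := e)
    (π := fun x => D.gain (meanVec Pr e) X (hom x))).iterate (k + 1)) (zero_le (a := fun y =>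
    ENNReal.ofReal (val X (D.offset (covMat Pr e) X) y))) x
  rwa [Function.iterate_fixed (hD.policyOp_gain he hX)] at this

lemma Problem.measurable_gain (D : Problem n m) :
    Measurable fun x : Fin n → ℝ => D.gain μ X (hom x) := by
  have : Continuous (hom : (Fin n → ℝ) → _) := by
    refine continuous_pi fun i => ?_
    rcases i with i | i
    · exact continuous_apply i
    · exact continuous_const
  unfold Problem.gain
  exact Continuous.measurable (by fun_prop)

/-! ### Fixed points of the Bellman operator -/

section FixedPoint

variable {q : (Fin n → ℝ) → (Fin m → ℝ) → ℝ}

/-- The infimum `β` of `q` satisfies `β ≥ γ β` because the stage-cost is non-negative, and `γ < 1`.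
-/
lemma Problem.IsFixedPoint.nonneg (hq : D.IsFixedPoint Pr e q) (hD : D.Regular)
    (x : Fin n → ℝ) (u : Fin m → ℝ) : 0 ≤ q x u := by
  obtain ⟨b, hb⟩ := hq.bddBelow
  have hbb : BddBelow (Set.range fun p : (Fin n → ℝ) × (Fin m → ℝ) => q p.1 p.2) :=
    ⟨b, Set.forall_mem_range.2 fun p => hb _ _⟩
  set β := ⨅ p : (Fin n → ℝ) × (Fin m → ℝ), q p.1 p.2 with hβ
  have hle : ∀ x u, β ≤ q x u := fun x u => ciInf_le hbb (x, u)
  have hstep : D.γ * β ≤ β := by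
    refine le_ciInf fun p => ?_
    have h1 : β ≤ ∫ ω, (⨅ w, q (D.dyn p.1 p.2 (e ω)) w) ∂Pr := by
      have := integral_mono (integrable_const β) (hq.integrable p.1 p.2)
        fun ω => le_ciInf fun w => hle _ w
      simpa using this
    have h2 := congr_fun (congr_fun hq.fixed p.1) p.2
    rw [← h2, Problem.bellmanQ]
    have := hD.cost_nonneg p.1 p.2
    have := mul_le_mul_of_nonneg_left h1 hD.γ_pos.le
    linarith
  have : 0 ≤ β := by nlinarith [hD.γ_lt]
  exact this.trans (hle x u)

omit [IsProbabilityMeasure Pr] in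
lemma Problem.IsFixedPoint.eq (hq : D.IsFixedPoint Pr e q) (x : Fin n → ℝ) (u : Fin m → ℝ) :
    q x u = D.cost x u + D.γ * ∫ ω, (⨅ w, q (D.dyn x u (e ω)) w) ∂Pr :=
  (congr_fun (congr_fun hq.fixed x) u).symm

omit [IsProbabilityMeasure Pr] in
lemma Problem.IsFixedPoint.iInf_le (hq : D.IsFixedPoint Pr e q) (x : Fin n → ℝ)
    (u : Fin m → ℝ) : ⨅ w, q x w ≤ q x u := by
  obtain ⟨b, hb⟩ := hq.bddBelow
  exact ciInf_le ⟨b, Set.forall_mem_range.2 fun w => hb _ _⟩ u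

/-- Every fixed point dominates the one built from the least Riccati solution. -/
lemma Problem.IsFixedPoint.qval_le (hq : D.IsFixedPoint Pr e q) (hD : D.Regular)
    (he : MemLp e 2 Pr) (hX : D.IsRiccatiSol (meanVec Pr e) X)
    (hlim : Tendsto (D.ricIter (meanVec Pr e)) atTop (𝓝 X)) (x : Fin n → ℝ) (u : Fin m → ℝ) :
    D.qval (meanVec Pr e) (covMat Pr e) X (D.offset (covMat Pr e) X) x u ≤ q x u := by
  have hS := covMat_posSemidef he
  have hstep : ∀ Z : Matrix (Fin n ⊕ Unit) (Fin n ⊕ Unit) ℝ, Z.PosSemidef → ∀ s,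
      (∀ x, val Z s x ≤ ⨅ w, q x w) → ∀ x u,
      D.qval (meanVec Pr e) (covMat Pr e) Z s x u ≤ q x u := by
    intro Z hZ s h x u
    rw [D.qval_eq he (isSymm_of_posSemidef hZ), hq.eq]
    have := integral_mono (D.integrable_val he (isSymm_of_posSemidef hZ) s x u)
      (hq.integrable x u) fun ω => h _
    have := mul_le_mul_of_nonneg_left this hD.γ_pos.le
    linarith
  have hval : ∀ k x, val (D.ricIter (meanVec Pr e) k)
      (D.offIter (meanVec Pr e) (covMat Pr e) k) x ≤ ⨅ w, q x w := by
    intro k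
    induction k with
    | zero =>
      intro x
      simp only [val, Problem.ricIter, Problem.offIter, qf_zero, add_zero]
      exact le_ciInf fun w => hq.nonneg hD x w
    | succ k ih =>
      intro x
      exact le_ciInf fun w => (hD.val_ric_le (hD.ricIter_posSemidef k) _ x w).trans
        (hstep _ (hD.ricIter_posSemidef k) _ ih x w)
  exact le_of_tendsto' (hD.tendsto_qval hS hX hlim x u) fun k =>
    hstep _ (hD.ricIter_posSemidef k) _ (hval k) x u

/-- A fixed point whose value function is controlled by the optimal one is the least one. -/
lemma Problem.IsFixedPoint.eq_qval (hq : D.IsFixedPoint Pr e q) (hD : D.Regular)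
    (hem : Measurable e) (he : MemLp e 2 Pr) (hX : D.IsRiccatiSol (meanVec Pr e) X)
    (hlim : Tendsto (D.ricIter (meanVec Pr e)) atTop (𝓝 X)) {C : ℝ}
    (hC : ∀ x, ⨅ w, q x w ≤ C * (1 + val X (D.offset (covMat Pr e) X) x)) :
    q = D.qval (meanVec Pr e) (covMat Pr e) X (D.offset (covMat Pr e) X) := by
  set π : (Fin n → ℝ) → (Fin m → ℝ) := fun x => D.gain (meanVec Pr e) X (hom x) with hπdef
  have hπ : Measurable π := D.measurable_gain
  set V : (Fin n → ℝ) → ℝ≥0∞ := fun y =>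
    ENNReal.ofReal (val X (D.offset (covMat Pr e) X) y) with hVdef
  have hVm : Measurable V := (continuous_val _ _).measurable.ennreal_ofReal
  have hVfix : D.policyOp Pr e π V = V := hD.policyOp_gain he hX
  have hvnn : ∀ x, 0 ≤ val X (D.offset (covMat Pr e) X) x :=
    val_nonneg hX.1 (hD.offset_nonneg hX.1 (covMat_posSemidef he))
  set T := D.policyOp Pr e π with hT
  set g := ENNReal.ofReal D.γ with hg
  have hg1 : g < 1 := by
    rw [hg, ENNReal.ofReal_lt_one]
    exact hD.γ_lt
  have hA := fun x => hD.tendsto_iterate_policyOp_gain he hX hlim x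
  have hA0 : ∀ N x, T^[N] 0 x =
      ∑ k ∈ Finset.range N, g ^ k * (D.trans Pr e π)^[k] (D.stage π) x := by
    intro N x
    have h0 : (D.trans Pr e π)^[N] 0 = 0 :=
      Function.iterate_fixed (by ext x; simp [Problem.trans]) N
    rw [hT, D.iterate_policyOp hem hπ measurable_zero, h0]
    simp [hg]
  have hsplit : ∀ (G : (Fin n → ℝ) → ℝ≥0∞), Measurable G → ∀ N x,
      T^[N] G x = T^[N] 0 x + g ^ N * (D.trans Pr e π)^[N] G x := by
    intro G hG N x
    rw [hA0, hT, D.iterate_policyOp hem hπ hG]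
  -- As `T^N V = V`, the tail is `V - T^N 0`, which tends to zero; finiteness of `V` permits the
  -- subtraction.
  have htail : ∀ x, Tendsto (fun N => g ^ N * (D.trans Pr e π)^[N] V x) atTop (𝓝 0) := by
    intro x
    have h1 : ∀ N, g ^ N * (D.trans Pr e π)^[N] V x = V x - T^[N] 0 x := by
      intro N
      have h2 := hsplit V hVm N x
      rw [Function.iterate_fixed hVfix] at h2
      rw [h2]
      refine (ENNReal.add_sub_cancel_left ?_).symm
      intro htop
      rw [htop, top_add] at h2
      exact ENNReal.ofReal_ne_top h2
    have h3 := ENNReal.Tendsto.sub (tendsto_const_nhds (x := V x)) (hA x)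
      (Or.inl ENNReal.ofReal_ne_top)
    rw [tsub_self] at h3
    exact h3.congr fun N => (h1 N).symm
  set v : (Fin n → ℝ) → ℝ := fun x => ⨅ w, q x w with hv
  have hv0 : ∀ x, 0 ≤ v x := fun x => le_ciInf fun w => hq.nonneg hD x w
  set G : (Fin n → ℝ) → ℝ≥0∞ := fun x => ENNReal.ofReal (v x) with hG
  set H : (Fin n → ℝ) → ℝ≥0∞ := ENNReal.ofReal C • (1 + V) with hH
  -- `ENNReal.ofReal` truncates a negative `C` to zero, so the bound is first weakened to `max C 0`.
  have hGH : G ≤ H := by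
    intro x
    have hC0 : C * (1 + val X (D.offset (covMat Pr e) X) x) ≤
        max C 0 * (1 + val X (D.offset (covMat Pr e) X) x) := by
      have := hvnn x
      gcongr
      exact le_max_left _ _
    have h1 : G x ≤ ENNReal.ofReal (max C 0 * (1 + val X (D.offset (covMat Pr e) X) x)) :=
      ENNReal.ofReal_le_ofReal ((hC x).trans hC0)
    refine h1.trans (le_of_eq ?_)
    rw [ENNReal.ofReal_mul (le_max_right _ _), ENNReal.ofReal_add zero_le_one (hvnn x),
      ENNReal.ofReal_max]
    simp only [ENNReal.ofReal_one, ENNReal.ofReal_zero, zero_le, sup_of_le_left, hH, hVdef,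
      Pi.smul_apply, Pi.add_apply, Pi.one_apply, smul_eq_mul]
  have hGT : G ≤ T G := by
    intro x
    have h1 : v x ≤ D.cost x (π x) + D.γ * ∫ ω, v (D.dyn x (π x) (e ω)) ∂Pr := by
      rw [← hq.eq]
      exact hq.iInf_le x (π x)
    refine (ENNReal.ofReal_le_ofReal h1).trans (le_of_eq ?_)
    rw [ENNReal.ofReal_add (hD.cost_nonneg _ _) (mul_nonneg hD.γ_pos.le
      (integral_nonneg fun ω => hv0 _)), ENNReal.ofReal_mul hD.γ_pos.le,
      ofReal_integral_eq_lintegral_ofReal (hq.integrable x (π x)) (ae_of_all _ fun ω => hv0 _)]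
    rfl
  have hTm : Monotone T := D.monotone_policyOp
  have hGN : ∀ N, G ≤ T^[N] H := by
    intro N
    refine le_trans ?_ (hTm.iterate N hGH)
    induction N with
    | zero => exact le_rfl
    | succ N ih =>
      rw [Function.iterate_succ_apply']
      exact hGT.trans (hTm ih)
  have hHN : ∀ N x, T^[N] H x = T^[N] 0 x +
      ENNReal.ofReal C * (g ^ N + g ^ N * (D.trans Pr e π)^[N] V x) := by
    intro N x
    rw [hsplit H ((measurable_one.add hVm).const_smul _), hH,
      D.iterate_trans_smul hem hπ (measurable_one.add hVm),
      D.iterate_trans_add hem hπ measurable_one hVm, D.iterate_trans_one]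
    simp only [Pi.smul_apply, Pi.add_apply, Pi.one_apply, smul_eq_mul]
    ring
  have hvV : ∀ x, v x ≤ val X (D.offset (covMat Pr e) X) x := by
    intro x
    have h1 : Tendsto (fun N => T^[N] H x) atTop (𝓝 (V x)) := by
      have h2 := (hA x).add (ENNReal.Tendsto.const_mul (a := ENNReal.ofReal C)
        ((ENNReal.tendsto_pow_atTop_nhds_zero_of_lt_one hg1).add (htail x))
        (Or.inr ENNReal.ofReal_ne_top))
      simp only [add_zero, mul_zero] at h2
      exact h2.congr fun N => (hHN N x).symm
    exact (ENNReal.ofReal_le_ofReal_iff (hvnn x)).1 (ge_of_tendsto' h1 fun N => hGN N x)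
  -- Leastness gives one inequality. For the other, one Bellman step carries `v ≤ V` over to the
  -- `Q`-functions.
  ext x u
  refine le_antisymm ?_ (hq.qval_le hD he hX hlim x u)
  rw [hq.eq, D.qval_eq he (isSymm_of_posSemidef hX.1)]
  have := integral_mono (hq.integrable x u)
    (D.integrable_val he (isSymm_of_posSemidef hX.1) (D.offset (covMat Pr e) X) x u)
    fun ω => hvV _
  have := mul_le_mul_of_nonneg_left this hD.γ_pos.le
  linarith

end FixedPoint

end Bellman

/-! ### Blocks of the augmented `Q`-matrix -/

section Blocks

variable {n m : ℕ} (D : Problem n m) (μ : Fin n → ℝ) (P : Matrix (Fin n) (Fin n) ℝ)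
  (Pl : Fin n → ℝ) (Pc : ℝ)

lemma Problem.augB_eq : D.augB = fromRows D.B 0 := by
  ext i j
  rcases i with i | i <;> simp [Problem.augB, augRows]

lemma Problem.augBlock_mul_augB :
    augBlock P Pl Pc * D.augB = fromRows (P * D.B) (replicateRow Unit Pl * D.B) := by
  rw [D.augB_eq, augBlock, fromBlocks_mul_fromRows]
  simp

lemma Problem.augqc_augBlock :
    D.augqc (augBlock P Pl Pc) = D.Luu + D.γ • (D.Bᵀ * P * D.B) := by
  rw [Problem.augqc, Matrix.mul_assoc, D.augBlock_mul_augB, D.augB_eq, transpose_fromRows,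
    fromCols_mul_fromRows, Matrix.mul_assoc]
  simp

/-- The last row is the constant term of the affine policy; symmetry of `P` turns `(c + μ)ᵀ P B`
into `Bᵀ P (c + μ)`. -/
lemma Problem.augql_augBlock (hP : P.IsSymm) :
    D.augql μ (augBlock P Pl Pc) = augRows (D.Lxu + D.γ • (D.Aᵀ * P * D.B))
      (D.Lu + D.γ • (D.Bᵀ *ᵥ (Pl + P *ᵥ (D.c + μ)))) := by
  rw [Problem.augql, Matrix.mul_assoc, D.augBlock_mul_augB, Problem.augA, fromBlocks_transpose,
    fromBlocks_mul_fromRows, Matrix.mul_assoc]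
  ext i j
  rcases i with i | i
  · simp [Problem.augLxu, augRows]
  · have h : ((replicateCol Unit (D.c + μ))ᵀ * (P * D.B)) i j = (D.Bᵀ *ᵥ (P *ᵥ (D.c + μ))) j := by
      rw [← Matrix.mul_assoc, transpose_replicateCol, ← replicateRow_vecMul,
        ← replicateRow_vecMul, replicateRow_apply, mulVec_transpose, ← mulVec_transpose P, hP.eq]
    have h' : (replicateRow Unit Pl * D.B) i j = (D.Bᵀ *ᵥ Pl) j := by
      rw [← replicateRow_vecMul, replicateRow_apply, mulVec_transpose]
    simp only [Problem.augLxu, augRows, Matrix.add_apply, Matrix.smul_apply, fromRows_apply_inr, h, h',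
      transpose_one, Matrix.one_mul, replicateRow_apply, Pi.add_apply, Pi.smul_apply, mulVec_add,
      smul_eq_mul]
    ring

lemma Problem.toBlocks₁₁_augq :
    (D.augq μ (augBlock P Pl Pc)).toBlocks₁₁ = D.Lxx + D.γ • (D.Aᵀ * P * D.A) := by
  rw [Problem.augq, Problem.augLxx, Problem.augA, augBlock, augBlock, fromBlocks_transpose,
    fromBlocks_multiply, fromBlocks_multiply, fromBlocks_smul, fromBlocks_add, toBlocks_fromBlocks₁₁]
  simp

end Blocks

/-! ### Uniqueness under quadratic growth -/

section Growth

variable {n m : ℕ} {D : Problem n m} {X Y : Matrix (Fin n ⊕ Unit) (Fin n ⊕ Unit) ℝ}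
  {μ : Fin n → ℝ} {S : Matrix (Fin n) (Fin n) ℝ}

lemma MemWeighted.exists_le {z g : (Fin n → ℝ) → (Fin m → ℝ) → ℝ} (h : MemWeighted z g)
    (hz : ∀ x u, 0 < z x u) : ∃ C, 0 ≤ C ∧ ∀ x u, g x u ≤ C * z x u := by
  obtain ⟨C, hC⟩ := h.2
  refine ⟨max C 0, le_max_right _ _, fun x u => ?_⟩
  have h1 := hC (Set.mem_range_self (x, u))
  rw [div_le_iff₀ (hz x u)] at h1
  refine (le_abs_self _).trans (h1.trans ?_)
  have := (hz x u).le
  gcongr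
  exact le_max_left _ _

lemma real_dotProduct_self_nonneg {ι : Type*} [Fintype ι] (y : ι → ℝ) : 0 ≤ y ⬝ᵥ y :=
  Finset.sum_nonneg fun _ _ => mul_self_nonneg _

lemma quadWeight_pos (x : Fin n → ℝ) (u : Fin m → ℝ) : 0 < quadWeight x u := by
  have := real_dotProduct_self_nonneg x
  have := real_dotProduct_self_nonneg u
  unfold quadWeight
  linarith

lemma hom_dotProduct_hom (x : Fin n → ℝ) : hom x ⬝ᵥ hom x = 1 + x ⬝ᵥ x := by
  simp [hom, add_comm]

lemma Problem.memWeighted_qval (D : Problem n m) (s : ℝ) :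
    MemWeighted quadWeight (D.qval μ S X s) := by
  refine ⟨(D.continuous_qval s).measurable, ?_⟩
  obtain ⟨C, hC0, hC⟩ := abs_qf_le (D.augQ μ X)
  refine ⟨C + |D.γ * (s + (X.toBlocks₁₁ * S).trace)|, Set.forall_mem_range.2 fun p => ?_⟩
  have hz := quadWeight_pos p.1 p.2
  rw [div_le_iff₀ hz, add_mul]
  refine (abs_add_le _ _).trans (add_le_add ?_ ?_)
  · refine (hC _).trans (le_of_eq ?_)
    rw [sumElim_dotProduct_sumElim, hom_dotProduct_hom, quadWeight]
  · have h1 := real_dotProduct_self_nonneg p.1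
    have h2 := real_dotProduct_self_nonneg p.2
    refine le_mul_of_one_le_right (abs_nonneg _) ?_
    unfold quadWeight
    linarith

lemma exists_quadWeight_gain_le (D : Problem n m) (μ : Fin n → ℝ)
    (X : Matrix (Fin n ⊕ Unit) (Fin n ⊕ Unit) ℝ) :
    ∃ C, 0 ≤ C ∧ ∀ x, quadWeight x (D.gain μ X (hom x)) ≤ C * (1 + x ⬝ᵥ x) := by
  set K := (D.augqc X)⁻¹ * (D.augql μ X)ᵀ with hK
  obtain ⟨C, hC0, hC⟩ := abs_qf_le (Kᵀ * (1 : Matrix (Fin m) (Fin m) ℝ) * K)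
  refine ⟨1 + C, by positivity, fun x => ?_⟩
  have h1 := (le_abs_self _).trans (hC (hom x))
  rw [qf_transpose_mul_mul, qf, one_mulVec, hom_dotProduct_hom] at h1
  have h2 : D.gain μ X (hom x) = -(K *ᵥ hom x) := by
    rw [Problem.gain, hK, mulVec_mulVec]
  rw [h2, quadWeight, neg_dotProduct_neg]
  linarith

lemma exists_le_val {P : Matrix (Fin n) (Fin n) ℝ} (hP : P.PosDef) (Pl : Fin n → ℝ) (Pc s : ℝ)
    (hnn : ∀ x, 0 ≤ val (augBlock P Pl Pc) s x) :
    ∃ C, 0 ≤ C ∧ ∀ x, 1 + x ⬝ᵥ x ≤ C * (1 + val (augBlock P Pl Pc) s x) := by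
  obtain ⟨c, hc, h⟩ := exists_le_qf_of_posDef hP
  -- Half of `c |x|²` absorbs the linear term by completing the square, at the price `2 / c *
  -- |Pl|²`.
  set E := 2 / c * (Pl ⬝ᵥ Pl) - Pc - s with hE
  refine ⟨1 + 2 / c * (1 + |E|), by positivity, fun x => ?_⟩
  have h1 : c / 2 * (x ⬝ᵥ x) ≤ val (augBlock P Pl Pc) s x + E := by
    have h2 := real_dotProduct_self_nonneg (c • x + (2 : ℝ) • Pl)
    have h3 : (c • x + (2 : ℝ) • Pl) ⬝ᵥ (c • x + (2 : ℝ) • Pl) =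
        2 * c * (c / 2 * (x ⬝ᵥ x) + 2 * (x ⬝ᵥ Pl) + 2 / c * (Pl ⬝ᵥ Pl)) := by
      simp only [add_dotProduct, dotProduct_add, smul_dotProduct, dotProduct_smul, smul_eq_mul]
      rw [dotProduct_comm Pl x]
      field_simp
      ring
    rw [h3] at h2
    have h4 := nonneg_of_mul_nonneg_right h2 (by positivity : 0 < 2 * c)
    have h5 := h x
    rw [val, qf_augBlock, hE]
    linarith
  have h2 := hnn x
  have h3 : x ⬝ᵥ x ≤ 2 / c * (val (augBlock P Pl Pc) s x + E) := by
    have := mul_le_mul_of_nonneg_left h1 (by positivity : 0 ≤ 2 / c)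
    have hcc : 2 / c * (c / 2 * (x ⬝ᵥ x)) = x ⬝ᵥ x := by field_simp
    linarith
  have h4 : val (augBlock P Pl Pc) s x + E ≤ (1 + |E|) * (1 + val (augBlock P Pl Pc) s x) := by
    nlinarith [le_abs_self E, abs_nonneg E, mul_nonneg (abs_nonneg E) h2]
  have h5 := mul_le_mul_of_nonneg_left h4 (by positivity : 0 ≤ 2 / c)
  linarith

variable {Ω : Type*} [MeasurableSpace Ω] {Pr : Measure Ω} [IsProbabilityMeasure Pr]
  {e : Ω → Fin n → ℝ} {q : (Fin n → ℝ) → (Fin m → ℝ) → ℝ}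

lemma Problem.IsFixedPoint.eq_qval_of_memWeighted (hq : D.IsFixedPoint Pr e q) (hD : D.Regular)
    (hem : Measurable e) (he : MemLp e 2 Pr) (hX : D.IsRiccatiSol (meanVec Pr e) X)
    (hlim : Tendsto (D.ricIter (meanVec Pr e)) atTop (𝓝 X))
    (hw : MemWeighted (fun x u => 1 +
      D.qval (meanVec Pr e) (covMat Pr e) X (D.offset (covMat Pr e) X) x u) q) :
    q = D.qval (meanVec Pr e) (covMat Pr e) X (D.offset (covMat Pr e) X) := by
  obtain ⟨C, -, hC⟩ := hw.exists_le fun x u => by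
    have := hD.qval_nonneg hX (covMat_posSemidef he) x u
    linarith
  refine hq.eq_qval hD hem he hX hlim (C := C) fun x => ?_
  rw [← hD.qval_gain hX]
  exact (hq.iInf_le x _).trans (hC x _)

lemma Problem.IsFixedPoint.eq_qval_of_posDef (hq : D.IsFixedPoint Pr e q) (hD : D.Regular)
    (hem : Measurable e) (he : MemLp e 2 Pr) (hX : D.IsRiccatiSol (meanVec Pr e) X)
    (hlim : Tendsto (D.ricIter (meanVec Pr e)) atTop (𝓝 X)) (hP : X.toBlocks₁₁.PosDef)
    (hw : MemWeighted quadWeight q) :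
    q = D.qval (meanVec Pr e) (covMat Pr e) X (D.offset (covMat Pr e) X) := by
  obtain ⟨C₁, hC₁0, hC₁⟩ := hw.exists_le quadWeight_pos
  obtain ⟨C₂, hC₂0, hC₂⟩ := exists_quadWeight_gain_le D (meanVec Pr e) X
  have hX' := exists_eq_augBlock (isSymm_of_posSemidef hX.1)
  have hnn := val_nonneg hX.1 (hD.offset_nonneg hX.1 (covMat_posSemidef he))
  obtain ⟨C₃, hC₃0, hC₃⟩ := exists_le_val hP (fun i => X (Sum.inl i) (Sum.inr ()))
    (X (Sum.inr ()) (Sum.inr ())) (D.offset (covMat Pr e) X) (by rwa [← hX'])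
  rw [← hX'] at hC₃
  refine hq.eq_qval hD hem he hX hlim (C := C₁ * (C₂ * C₃)) fun x => ?_
  calc ⨅ w, q x w ≤ q x (D.gain (meanVec Pr e) X (hom x)) := hq.iInf_le x _
    _ ≤ C₁ * quadWeight x (D.gain (meanVec Pr e) X (hom x)) := hC₁ x _
    _ ≤ C₁ * (C₂ * (1 + x ⬝ᵥ x)) := by gcongr; exact hC₂ x
    _ ≤ C₁ * (C₂ * (C₃ * (1 + val X (D.offset (covMat Pr e) X) x))) := by gcongr; exact hC₃ x
    _ = _ := by ring

/-- If the optimal value grows quadratically, then the Riccati equation has only one positive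
semidefinite solution: another one would yield another fixed point of the Bellman operator. -/
lemma Problem.Regular.riccatiSol_unique (hD : D.Regular) (hem : Measurable e) (he : MemLp e 2 Pr)
    (hX : D.IsRiccatiSol (meanVec Pr e) X)
    (hlim : Tendsto (D.ricIter (meanVec Pr e)) atTop (𝓝 X)) (hP : X.toBlocks₁₁.PosDef)
    (hY : D.IsRiccatiSol (meanVec Pr e) Y) : Y = X := by
  have hq := (hD.isFixedPoint_qval he hY).eq_qval_of_posDef hD hem he hX hlim hP
    (D.memWeighted_qval _)
  have hval : ∀ x, val Y (D.offset (covMat Pr e) Y) x = val X (D.offset (covMat Pr e) X) x := by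
    intro x
    rw [← hD.iInf_qval hY, hq, hD.iInf_qval hX]
  have hXs := isSymm_of_posSemidef hX.1
  have hYs := isSymm_of_posSemidef hY.1
  have hs : (Y - X).IsSymm := hYs.sub hXs
  obtain ⟨M, a, t, hM, hMat⟩ : ∃ M a t, M.IsSymm ∧ Y - X = augBlock M a t :=
    ⟨_, _, _, hs.submatrix Sum.inl, exists_eq_augBlock hs⟩
  -- The quadratic polynomial of `Y - X` is constant in `x`. Comparing `0`, `x` and `-x` kills its
  -- quadratic part, and `x = a` its linear part.
  have hform : ∀ x, qf M x + 2 * (x ⬝ᵥ a) + t =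
      D.offset (covMat Pr e) X - D.offset (covMat Pr e) Y := by
    intro x
    rw [← qf_augBlock, ← hMat, qf_sub]
    have := hval x
    simp only [val] at this
    linarith
  have h0 := hform 0
  simp only [qf_zero_vec, zero_dotProduct] at h0
  have hneg : ∀ x, qf M (-x) = qf M x := fun x => by simp [qf, mulVec_neg]
  have hM0 : M = 0 := by
    refine eq_of_qf_eq hM (isSymm_zero) fun x => ?_
    have h1 := hform x
    have h2 := hform (-x)
    rw [hneg, neg_dotProduct] at h2
    rw [qf_zero]
    linarith
  have ha0 : a = 0 := by
    have h1 := hform a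
    rw [hM0, qf_zero] at h1
    exact dotProduct_self_eq_zero.1 (by linarith)
  have hblock : Y.toBlocks₁₁ = X.toBlocks₁₁ := by
    have h1 : (Y - X).toBlocks₁₁ = 0 := by
      rw [hMat, hM0, augBlock, toBlocks_fromBlocks₁₁]
    exact sub_eq_zero.1 h1
  -- Equal values fix only the sum of the constant entry and the offset; the offsets agree because
  -- they depend on the upper-left block alone.
  have ht0 : t = 0 := by
    rw [Problem.offset, Problem.offset, hblock, sub_self] at h0
    linarith
  refine sub_eq_zero.1 ?_
  rw [hMat, hM0, ha0, ht0]
  ext i j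
  rcases i with i | i <;> rcases j with j | j <;> simp [augBlock]

end Growth

/-! ### Optimal policies -/

section Optimal

variable {n m : ℕ} {D : Problem n m} {X : Matrix (Fin n ⊕ Unit) (Fin n ⊕ Unit) ℝ}
  {Ω : Type*} [MeasurableSpace Ω] {Pr : Measure Ω} [IsProbabilityMeasure Pr]
  {ξ : ℕ → Ω → Fin n → ℝ} {π : (Fin n → ℝ) → (Fin m → ℝ)}

/-- Retaining the first input `π x`, instead of minimizing over it, is what makes the optimal policy
unique: optimality forces `π x` to attain the minimum of the `Q`-function. -/
lemma Problem.Regular.qval_le_policyCost (hD : D.Regular) (hξ : ∀ k, Measurable (ξ k))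
    (hindep : iIndepFun ξ Pr) (hident : ∀ k, IdentDistrib (ξ k) (ξ 0) Pr Pr)
    (he : MemLp (ξ 0) 2 Pr) (hX : D.IsRiccatiSol (meanVec Pr (ξ 0)) X)
    (hlim : Tendsto (D.ricIter (meanVec Pr (ξ 0))) atTop (𝓝 X)) (hπ : Measurable π)
    (x : Fin n → ℝ) :
    ENNReal.ofReal (D.qval (meanVec Pr (ξ 0)) (covMat Pr (ξ 0)) X
      (D.offset (covMat Pr (ξ 0)) X) x (π x)) ≤ D.policyCost Pr ξ π x :=
  le_of_tendsto' (ENNReal.tendsto_ofReal (hD.tendsto_qval (covMat_posSemidef he) hX hlim x (π x)))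
    fun k => (hD.qval_ricIter_le he k x).trans
      (D.iterate_policyOp_zero_le hD.γ_pos.le hξ hindep hident hπ x (k + 1))

lemma Problem.Regular.policyCost_gain (hD : D.Regular) (hξ : ∀ k, Measurable (ξ k))
    (hindep : iIndepFun ξ Pr) (hident : ∀ k, IdentDistrib (ξ k) (ξ 0) Pr Pr)
    (he : MemLp (ξ 0) 2 Pr) (hX : D.IsRiccatiSol (meanVec Pr (ξ 0)) X)
    (hlim : Tendsto (D.ricIter (meanVec Pr (ξ 0))) atTop (𝓝 X)) (x : Fin n → ℝ) :
    D.policyCost Pr ξ (fun x => D.gain (meanVec Pr (ξ 0)) X (hom x)) x =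
      ENNReal.ofReal (val X (D.offset (covMat Pr (ξ 0)) X) x) :=
  tendsto_nhds_unique
    (D.tendsto_policyCost hD.γ_pos.le hξ hindep hident D.measurable_gain x)
    (hD.tendsto_iterate_policyOp_gain he hX hlim x)

lemma Problem.Regular.isOptimalPolicy_iff (hD : D.Regular) (hξ : ∀ k, Measurable (ξ k))
    (hindep : iIndepFun ξ Pr) (hident : ∀ k, IdentDistrib (ξ k) (ξ 0) Pr Pr)
    (he : MemLp (ξ 0) 2 Pr) (hX : D.IsRiccatiSol (meanVec Pr (ξ 0)) X)
    (hlim : Tendsto (D.ricIter (meanVec Pr (ξ 0))) atTop (𝓝 X)) :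
    D.IsOptimalPolicy Pr ξ π ↔ π = fun x => D.gain (meanVec Pr (ξ 0)) X (hom x) := by
  have hval := hD.policyCost_gain hξ hindep hident he hX hlim
  constructor
  · rintro ⟨hπ, hopt⟩
    ext1 x
    have h1 := (hD.qval_le_policyCost hξ hindep hident he hX hlim hπ x).trans
      (hopt (fun x => D.gain (meanVec Pr (ξ 0)) X (hom x)) D.measurable_gain x)
    rw [hval, ENNReal.ofReal_le_ofReal_iff
      (val_nonneg hX.1 (hD.offset_nonneg hX.1 (covMat_posSemidef he)) x)] at h1
    exact (hD.qval_le_val_iff hX x (π x)).1 h1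
  · rintro rfl
    refine ⟨D.measurable_gain, fun π' hπ' x => ?_⟩
    rw [hval]
    exact (ENNReal.ofReal_le_ofReal (hD.val_le_qval hX x (π' x))).trans
      (hD.qval_le_policyCost hξ hindep hident he hX hlim hπ' x)

end Optimal

end AffineLQ

end

/-! ### Assembly of the claim -/

theorem proposition2 {n m : ℕ} (D : AffineLQ.Problem n m)
    (hγ0 : 0 < D.γ) (hγ1 : D.γ < 1)
    (hstab : AffineLQ.IsStabilizable (Real.sqrt D.γ • D.A) (Real.sqrt D.γ • D.B))
    (hLxx : D.Lxx.IsSymm) (hLuu : D.Luu.IsSymm)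
    (hcost : ∀ x u, 0 ≤ D.cost x u)
    (hinf : ∀ (x : Fin n → ℝ) (r : ℝ), IsCompact {u : Fin m → ℝ | D.cost x u ≤ r})
    {Ω : Type*} [MeasurableSpace Ω] (Pr : Measure Ω) [IsProbabilityMeasure Pr]
    (ξ : ℕ → Ω → Fin n → ℝ) (hmeas : ∀ k, Measurable (ξ k))
    (hindep : iIndepFun ξ Pr) (hident : ∀ k, IdentDistrib (ξ k) (ξ 0) Pr Pr)
    (hL2 : MemLp (ξ 0) 2 Pr)
    (μ : Fin n → ℝ) (hμ : μ = AffineLQ.meanVec Pr (ξ 0))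
    (S : Matrix (Fin n) (Fin n) ℝ) (hS : S = AffineLQ.covMat Pr (ξ 0)) :
    ∃ (P : Matrix (Fin n) (Fin n) ℝ) (Pl : Fin n → ℝ) (Pc : ℝ)
      (q : Matrix (Fin n) (Fin n) ℝ) (ql : Matrix (Fin n) (Fin m) ℝ)
      (qc : Matrix (Fin m) (Fin m) ℝ) (qx : Fin n → ℝ) (qu : Fin m → ℝ) (Qc : ℝ)
      (Pt : Matrix (Fin n ⊕ Unit) (Fin n ⊕ Unit) ℝ)
      (qstar : (Fin n → ℝ) → (Fin m → ℝ) → ℝ)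
      (πstar : (Fin n → ℝ) → (Fin m → ℝ)),
      -- the least positive semidefinite solution of the augmented Riccati equation
      Pt = AffineLQ.augBlock P Pl Pc ∧
      D.IsRiccatiSol μ Pt ∧
      (∀ Pt', D.IsRiccatiSol μ Pt' → (Pt' - Pt).PosSemidef) ∧
      (D.augCost.PosDef → Pt.PosDef) ∧
      (P.PosDef → ∀ Pt', D.IsRiccatiSol μ Pt' → Pt' = Pt) ∧
      -- identification of the blocks
      D.augQ μ Pt = Matrix.fromBlocks (AffineLQ.augBlock q qx Qc) (AffineLQ.augRows ql qu)
        (AffineLQ.augRows ql qu)ᵀ qc ∧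
      q = D.Lxx + D.γ • (D.Aᵀ * P * D.A) ∧
      ql = D.Lxu + D.γ • (D.Aᵀ * P * D.B) ∧
      qc = D.Luu + D.γ • (D.Bᵀ * P * D.B) ∧
      -- the fixed point of the Bellman operator
      (∀ x u, qstar x u =
        AffineLQ.genQuad q ql qc qx qu Qc x u + D.γ * (P * S).trace / (1 - D.γ)) ∧
      D.IsFixedPoint Pr (ξ 0) qstar ∧
      (∀ x u, 0 ≤ qstar x u) ∧
      AffineLQ.MemWeighted AffineLQ.quadWeight qstar ∧
      (∀ q', D.IsFixedPoint Pr (ξ 0) q' → ∀ x u, qstar x u ≤ q' x u) ∧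
      (∀ q', D.IsFixedPoint Pr (ξ 0) q' →
        AffineLQ.MemWeighted (fun x u => 1 + qstar x u) q' → q' = qstar) ∧
      (P.PosDef → ∀ q', D.IsFixedPoint Pr (ξ 0) q' →
        AffineLQ.MemWeighted AffineLQ.quadWeight q' → q' = qstar) ∧
      -- the optimal policy
      qc.PosDef ∧
      (∀ x, πstar x =
        -(qc⁻¹ *ᵥ (qlᵀ *ᵥ x + (D.Lu + D.γ • (D.Bᵀ *ᵥ (Pl + P *ᵥ (D.c + μ))))))) ∧
      (∀ x u, (∀ w, qstar x u ≤ qstar x w) ↔ u = πstar x) ∧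
      (∀ x, D.policyCost Pr ξ πstar x = ENNReal.ofReal (⨅ w, qstar x w)) ∧
      (∀ π, D.IsOptimalPolicy Pr ξ π ↔ π = πstar) := by
  have hD : D.Regular := ⟨hγ0, hγ1, hstab, hLxx, hLuu, hcost, hinf⟩
  subst hμ hS
  obtain ⟨X, hX, hlim⟩ := hD.exists_riccatiSol (AffineLQ.meanVec Pr (ξ 0))
  have hXs := AffineLQ.isSymm_of_posSemidef hX.1
  have hcov := AffineLQ.covMat_posSemidef hL2
  obtain ⟨P, Pl, Pc, hPs, hXP, hPX⟩ : ∃ P Pl Pc, P.IsSymm ∧ X = AffineLQ.augBlock P Pl Pc ∧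
      X.toBlocks₁₁ = P :=
    ⟨_, _, _, hXs.submatrix Sum.inl, AffineLQ.exists_eq_augBlock hXs, rfl⟩
  have hq := AffineLQ.exists_eq_augBlock (hD.isSymm_augq (μ := AffineLQ.meanVec Pr (ξ 0)) hXs)
  have hq₁ := D.toBlocks₁₁_augq (AffineLQ.meanVec Pr (ξ 0)) P Pl Pc
  have hql := D.augql_augBlock (AffineLQ.meanVec Pr (ξ 0)) P Pl Pc hPs
  have hqc := D.augqc_augBlock P Pl Pc
  rw [← hXP] at hq₁ hql hqc
  rw [hq₁] at hq
  have hQ : D.augQ (AffineLQ.meanVec Pr (ξ 0)) X = Matrix.fromBlocks _ _ _ _ := rfl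
  rw [hq, hql, hqc] at hQ
  refine ⟨P, Pl, Pc, _, _, _, _, _, _, X,
    D.qval (AffineLQ.meanVec Pr (ξ 0)) (AffineLQ.covMat Pr (ξ 0)) X
      (D.offset (AffineLQ.covMat Pr (ξ 0)) X),
    fun x => D.gain (AffineLQ.meanVec Pr (ξ 0)) X (AffineLQ.hom x), hXP, hX, ?_, ?_, ?_, hQ, rfl,
    rfl, rfl, ?_, hD.isFixedPoint_qval hL2 hX, hD.qval_nonneg hX hcov, D.memWeighted_qval _,
    fun q' hq' => hq'.qval_le hD hL2 hX hlim,
    fun q' hq' => hq'.eq_qval_of_memWeighted hD (hmeas 0) hL2 hX hlim, ?_, ?_,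
    fun x => by simp only [AffineLQ.Problem.gain, hql, hqc, AffineLQ.augRows_transpose_mulVec],
    ?_, ?_, ?_⟩
  · refine fun Y hY => AffineLQ.posSemidef_iff_qf.2
      ⟨(AffineLQ.isSymm_of_posSemidef hY.1).sub hXs, fun y => ?_⟩
    rw [AffineLQ.qf_sub]
    exact sub_nonneg.2 (le_of_tendsto' (AffineLQ.tendsto_qf hlim y) fun k => hD.ricIter_le hY k y)
  · refine fun hL => AffineLQ.posDef_iff_qf.2 ⟨hXs, fun y hy => ?_⟩
    rw [(hD.isRiccatiSol_iff.1 hX).2, hD.qf_ric_eq hX.1]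
    -- The stage-cost term alone is positive, since `y ≠ 0` makes the pair of `y` and its input
    -- nonzero.
    refine add_pos_of_pos_of_nonneg ((AffineLQ.posDef_iff_qf.1 hL).2 _ fun h0 => hy ?_)
      (mul_nonneg hγ0.le (AffineLQ.qf_nonneg hX.1 _))
    ext i
    exact congr_fun h0 (Sum.inl i)
  · exact fun hP Y hY => hD.riccatiSol_unique (hmeas 0) hL2 hX hlim (hPX ▸ hP) hY
  · intro x u
    rw [← AffineLQ.qf_augBlock_fromBlocks, ← hQ, AffineLQ.Problem.qval, hD.offset_eq,
      AffineLQ.Problem.offset, hPX]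
  · exact fun hP q' hq' => hq'.eq_qval_of_posDef hD (hmeas 0) hL2 hX hlim (hPX ▸ hP)
  · exact hqc ▸ hD.augqc_posDef hX.1
  · intro x u
    rw [← hD.qval_le_val_iff (S := AffineLQ.covMat Pr (ξ 0)) hX, ← hD.iInf_qval hX]
    refine ⟨fun h => le_ciInf h, fun h w => h.trans ?_⟩
    rw [hD.iInf_qval hX]
    exact hD.val_le_qval hX x w
  · intro x
    rw [hD.policyCost_gain hmeas hindep hident hL2 hX hlim, hD.iInf_qval hX]
  · exact fun π => hD.isOptimalPolicy_iff hmeas hindep hident hL2 hX hlim
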